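/- Let $k$ be a field of characteristic $p>0$, and let $n\ge 5$ and $d\ge 1$ be integers. Put $$E=\left\lfloor\frac{n(d-1)+3}{2}\right\rfloor .$$ Let $Q=k[x_1,\dots,x_{n-1}]$ with its standard grading, let $g_i=x_i^d$ for $1\le i\le n-1$ and $g_n=(x_1+\dots+x_{n-1})^d$. Let $\mathrm{Syz}$ be the kernel of the homogeneous map $Q(-d)^n\to Q$ given by the matrix $[g_1,\dots,g_n]$, let $\mathrm{Kos}\subseteq\mathrm{Syz}$ be the submodule generated by the Koszul relations $g_je_i-g_ie_j$ ($1\le i<j\le n$), where $e_1,\dots,e_n$ is the standard basis, and let $\overline{\mathrm{Syz}}=\mathrm{Syz}/\mathrm{Kos}$, a graded $Q$-module. For a graded module $M=\bigoplus_{i\in\mathbb Z}M_i$ and an integer $i_0$, write $i_0\le\operatorname{mgd}M$ if $M_i=0$ for all $i<i_0$. Then: 1. $E\le\operatorname{mgd}\overline{\mathrm{Syz}}$ if and only if $E\le p$. 2. If $k$ is infinite, then the ring $A=k[x_1,\dots,x_n]/(x_1^d,\dots,x_n^d)$ has the weak Lefschetz property if and only if $\left\lfloor\frac{n(d-1)+3}{2}\right\rfloor\le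 p$. Here $A$ has the weak Lefschetz property if there is a linear form $L\in A_1$ such that for every $i\ge 0$ the multiplication map $L\colon A_i\to A_{i+1}$ has maximal rank, i.e. is injective or surjective. -/

import Mathlib

noncomputable section

namespace LefschetzCI

open MvPolynomial

/-- `i₀ ≤ mgd M` for a `ℤ`-graded module `M = ⨁ᵢ Mᵢ` with graded pieces `ℳ i = Mᵢ`:
`Mᵢ = 0` for all `i < i₀`. (For `M = 0` this holds for every `i₀`, that is `mgd M = ∞`.) -/
def LeMgd {k M : Type*} [Field k] [AddCommGroup M] [Module k M]
    (i₀ : ℤ) (ℳ : ℤ → Submodule k M) : Prop :=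
  ∀ i : ℤ, i < i₀ → ℳ i = ⊥

/-- `|a| = a₁ + ⋯ + aₙ`. -/
def size (n : ℕ) (a : Fin n → ℕ) : ℤ := ∑ i, (a i : ℤ)

/-- `E(n, a) = ⌊(|a| - n + 3) / 2⌋`; division of integers by `2` rounds down. -/
def E (n : ℕ) (a : Fin n → ℕ) : ℤ := (size n a - n + 3) / 2

section Syzygies

variable (k : Type*) [Field k] (n : ℕ) (a : Fin n → ℕ)

/-- The polynomial ring `Q = k[x₁, …, x_{n-1}]`. -/
abbrev Q : Type _ := MvPolynomial (Fin (n - 1)) k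

/-- The degree `i` piece of `Q`, as a `ℤ`-graded ring (it is `0` for `i < 0`). -/
def Qdeg (i : ℤ) : Submodule k (Q k n) :=
  if 0 ≤ i then homogeneousSubmodule (Fin (n - 1)) k i.toNat else ⊥

/-- The forms `x₁^{a₁}, …, x_{n-1}^{a_{n-1}}, (x₁ + ⋯ + x_{n-1})^{aₙ}` of `Q`. -/
def forms (i : Fin n) : Q k n :=
  if h : i.val < n - 1 then X ⟨i.val, h⟩ ^ a i else (∑ j, X j) ^ a i

/-- The degree `i` piece of the graded free module `⨁ⱼ Q(-aⱼ)`. -/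
def freeDeg (i : ℤ) : Submodule k (Fin n → Q k n) :=
  Submodule.pi Set.univ fun j => Qdeg k n (i - a j)

/-- The map `ξ : ⨁ⱼ Q(-aⱼ) → Q` given by the row matrix of the forms. -/
def xi : (Fin n → Q k n) →ₗ[Q k n] Q k n :=
  Fintype.linearCombination (Q k n) (forms k n a)

/-- The syzygy module, the kernel of `ξ`. -/
def Syz : Submodule (Q k n) (Fin n → Q k n) := LinearMap.ker (xi k n a)

/-- The submodule generated by the Koszul relations `gⱼ eᵢ - gᵢ eⱼ`. -/
def Kos : Submodule (Q k n) (Fin n → Q k n) :=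
  Submodule.span (Q k n)
    {v | ∃ i j : Fin n, i < j ∧
      v = Pi.single i (forms k n a j) - Pi.single j (forms k n a i)}

theorem kos_le_syz : Kos k n a ≤ Syz k n a := by
  refine Submodule.span_le.2 ?_
  rintro v ⟨i, j, -, rfl⟩
  simp [Syz, xi, Fintype.linearCombination_apply_single, mul_comm]

/-- The module of non-Koszul syzygies, `Syz / Kos`. -/
abbrev SyzBar : Type _ := ↥(Syz k n a) ⧸ (Kos k n a).submoduleOf (Syz k n a)

/-- The degree `i` piece of `Syz / Kos`: the classes of the homogeneous syzygies of degree `i`. -/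
def SyzBarDeg (i : ℤ) : Submodule k (SyzBar k n a) :=
  ((freeDeg k n a i).comap ((Syz k n a).subtype.restrictScalars k)).map
    (((Kos k n a).submoduleOf (Syz k n a)).mkQ.restrictScalars k)

end Syzygies

section WeakLefschetz

/-- Multiplication by an element `L` of degree one, as a linear map `Aᵢ → Aᵢ₊₁`. -/
def mulMap {k A : Type*} [Field k] [CommRing A] [Algebra k A] (𝒜 : ℕ → Submodule k A)
    [SetLike.GradedMonoid 𝒜] {L : A} (hL : L ∈ 𝒜 1) (i : ℕ) : 𝒜 i →ₗ[k] 𝒜 (i + 1) :=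
  (LinearMap.mulRight k L).restrict fun _ hx => SetLike.mul_mem_graded hx hL

/-- The weak Lefschetz property of a standard graded algebra `A = ⨁ᵢ Aᵢ` over `k`, with graded
pieces `𝒜 i = Aᵢ` (of finite dimension): multiplication by some linear form has maximal rank,
which is to say is injective or surjective, from `Aᵢ` to `Aᵢ₊₁` for each `i`. -/
def HasWLP {k A : Type*} [Field k] [CommRing A] [Algebra k A] (𝒜 : ℕ → Submodule k A)
    [SetLike.GradedMonoid 𝒜] : Prop :=
  ∃ (L : A) (hL : L ∈ 𝒜 1), ∀ i : ℕ,
    Function.Injective (mulMap 𝒜 hL i) ∨ Function.Surjective (mulMap 𝒜 hL i)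

variable (k : Type*) [Field k] (n : ℕ) (a : Fin n → ℕ)

/-- The ideal `(x₁^{a₁}, …, xₙ^{aₙ})` of `k[x₁, …, xₙ]`. -/
def powIdeal : Ideal (MvPolynomial (Fin n) k) :=
  Ideal.span (Set.range fun i : Fin n => (X i : MvPolynomial (Fin n) k) ^ a i)

/-- The ring `A = k[x₁, …, xₙ] / (x₁^{a₁}, …, xₙ^{aₙ})`. -/
abbrev A : Type _ := MvPolynomial (Fin n) k ⧸ powIdeal k n a

/-- The degree `i` piece of `A`: the classes of the homogeneous polynomials of degree `i`. -/
def Adeg (i : ℕ) : Submodule k (A k n a) :=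
  (homogeneousSubmodule (Fin n) k i).map (Ideal.Quotient.mkₐ k (powIdeal k n a)).toLinearMap

instance gradedMonoid_Adeg : SetLike.GradedMonoid (Adeg k n a) where
  one_mem := ⟨1, isHomogeneous_one _ _, map_one (Ideal.Quotient.mkₐ k (powIdeal k n a))⟩
  mul_mem := by
    rintro i j _ _ ⟨f, hf, rfl⟩ ⟨g, hg, rfl⟩
    exact ⟨f * g, IsHomogeneous.mul hf hg, map_mul (Ideal.Quotient.mkₐ k (powIdeal k n a)) f g⟩

end WeakLefschetz

end LefschetzCI

end

noncomputable section

namespace LefschetzCI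

open MvPolynomial

/-! ### Monomial complete intersections and their socle -/

section MonomialIdeals

variable {k : Type*} [Field k] {σ : Type*}

/-! Let I = (x_1^d, ..., x_n^d) and L = x_1 + ... + x_n. Both claims reduce to one question: does L
kill a nonzero class of k[x]/I in some degree e with 2e + 1 ≤ n(d-1)? `HasKer` with exponent 1
records such a class.

If E ≤ p there is none (`not_hasKer`). Multiplication by L and the operator `lower` satisfy the sl₂
commutation relation. On a killed class f moved up to the middle degree i, L^i D^i f is a scalar
multiple of f, the scalar being a product of integers that p does not divide; and D^i f is a
constant, which must vanish because L^(i+1) ∉ I.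

If E > p there is one (`exists_hasKer`). For q = p^s, L^q is the sum of the x_j^q, so it suffices to
find a class of low degree killed by that sum and multiply by L until just before it dies
(`HasKer.of_pow_char`). If d ≤ q the class of 1 works. Otherwise classes are pulled back by x_j ↦
x_j^q from smaller exponents (`HasKer.expand`), assembled from two or three variables at a time; n =
5 and n = 6 suffice, as a further pair of variables can always be added in its middle degree.

Syzygies: modulo Koszul relations a syzygy is determined by its last entry, a class killed by (x_1 +
... + x_{n-1})^d (`mem_kos_of_last_mem`). Such classes correspond to classes killed by L in one more
variable (`hasKer_cons`, `exists_syzygy_of_hasKer`).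

Lefschetz property: Gorenstein duality turns injectivity below the middle into surjectivity above it
(`hasKer_of_not_surjective`). Conversely, over an infinite field any Lefschetz form can be perturbed
to have no zero coefficient, then rescaled to L. -/

theorem mem_span_X_pow_image {a : σ → ℕ} {S : Set σ} {f : MvPolynomial σ k} :
    f ∈ Ideal.span ((fun i => (X i : MvPolynomial σ k) ^ a i) '' S) ↔
      ∀ m ∈ f.support, ∃ i ∈ S, a i ≤ m i := by
  have h := @mem_ideal_span_monomial_image σ k _ f ((fun i => Finsupp.single i (a i)) '' S)
  rw [Set.image_image] at h
  simpa [X_pow_eq_monomial] using h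

variable (k) in
/-- The ideal generated by the powers `xᵢ ^ aᵢ` of the variables. -/
def monIdeal (a : σ → ℕ) : Ideal (MvPolynomial σ k) :=
  Ideal.span (Set.range fun i => (X i : MvPolynomial σ k) ^ a i)

theorem mem_monIdeal {a : σ → ℕ} {f : MvPolynomial σ k} :
    f ∈ monIdeal k a ↔ ∀ m, (∀ i, m i < a i) → coeff m f = 0 := by
  rw [monIdeal, ← Set.image_univ, mem_span_X_pow_image]
  refine forall_congr' fun m => ?_
  rw [mem_support_iff]
  constructor
  · intro h hm
    by_contra h0
    obtain ⟨i, -, hi⟩ := h h0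
    exact absurd (hm i) (not_lt.2 hi)
  · intro h h0
    by_contra! hc
    exact h0 (h fun i => hc i trivial)

theorem notMem_monIdeal {a : σ → ℕ} {f : MvPolynomial σ k} :
    f ∉ monIdeal k a ↔ ∃ m, (∀ i, m i < a i) ∧ coeff m f ≠ 0 := by
  simp [mem_monIdeal]

theorem X_pow_mem_monIdeal (a : σ → ℕ) (i : σ) {c : ℕ} (h : a i ≤ c) :
    (X i : MvPolynomial σ k) ^ c ∈ monIdeal k a :=
  Ideal.pow_mem_of_pow_mem _ (Ideal.subset_span ⟨i, rfl⟩) h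

theorem C_mul_mem_iff {I : Ideal (MvPolynomial σ k)} {c : k} (hc : c ≠ 0)
    {f : MvPolynomial σ k} : C c * f ∈ I ↔ f ∈ I := by
  refine ⟨fun h => ?_, fun h => I.mul_mem_left _ h⟩
  have := I.mul_mem_left (C c⁻¹) h
  rwa [← mul_assoc, ← C_mul, inv_mul_cancel₀ hc, C_1, one_mul] at this

theorem coeff_ne_zero_degree {f : MvPolynomial σ k} {e : ℕ} (hf : f.IsHomogeneous e)
    {m : σ →₀ ℕ} (hm : coeff m f ≠ 0) : m.degree = e := by
  by_contra h
  exact hm (hf.coeff_eq_zero h)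

variable [Fintype σ]

theorem exists_X_mul_notMem {d e : ℕ} {f : MvPolynomial σ k} (hf : f.IsHomogeneous e)
    (hfI : f ∉ monIdeal k (fun _ : σ => d)) (he : e < Fintype.card σ * (d - 1)) :
    ∃ i : σ, X i * f ∉ monIdeal k (fun _ : σ => d) := by
  obtain ⟨m, hm, hc⟩ := notMem_monIdeal.1 hfI
  have hdeg := coeff_ne_zero_degree hf hc
  obtain ⟨i, hi⟩ : ∃ i, m i < d - 1 := by
    by_contra! h
    have : ∑ _i : σ, (d - 1) ≤ ∑ i, m i := Finset.sum_le_sum fun i _ => h i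
    rw [Finset.sum_const, Finset.card_univ, smul_eq_mul, ← Finsupp.degree_eq_sum, hdeg] at this
    omega
  classical
  refine ⟨i, notMem_monIdeal.2 ⟨Finsupp.single i 1 + m, fun j => ?_, by rwa [coeff_X_mul]⟩⟩
  rcases eq_or_ne i j with rfl | h
  · simp; omega
  · simpa [h] using hm j

/-- The socle of a monomial complete intersection is concentrated in the top degree. -/
theorem exists_mul_notMem {d e : ℕ} (t : ℕ) {f : MvPolynomial σ k} (hf : f.IsHomogeneous e)
    (hfI : f ∉ monIdeal k (fun _ : σ => d)) (he : e + t ≤ Fintype.card σ * (d - 1)) :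
    ∃ w : MvPolynomial σ k, w.IsHomogeneous t ∧ w * f ∉ monIdeal k (fun _ : σ => d) := by
  induction t with
  | zero => exact ⟨1, isHomogeneous_one _ _, by rwa [one_mul]⟩
  | succ t ih =>
    obtain ⟨w, hw, hwf⟩ := ih (by omega)
    obtain ⟨i, hi⟩ := exists_X_mul_notMem (hw.mul hf) hwf (by omega)
    refine ⟨X i * w, ?_, by rwa [mul_assoc]⟩
    rw [add_comm]
    exact (isHomogeneous_X _ _).mul hw

end MonomialIdeals

/-! ### The sl₂-action: commuting the lowering operator past the sum of the variables -/

section Lowering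

variable {k : Type*} [Field k] {σ : Type*} [Fintype σ]

variable (k σ) in
/-- The sum of the variables. -/
def sumX : MvPolynomial σ k := ∑ j, X j

theorem isHomogeneous_sumX : (sumX k σ).IsHomogeneous 1 :=
  IsHomogeneous.sum _ _ _ fun i _ => isHomogeneous_X _ i

variable (k σ) in
/-- The lowering operator of the `sl₂`-action on the monomial complete intersection with
exponents `e + 1`; the raising operator is multiplication by the sum of the variables. -/
def lower (e : ℕ) : MvPolynomial σ k →ₗ[k] MvPolynomial σ k :=
  ∑ j, (e • (pderiv j).toLinearMap -
    LinearMap.mulLeft k (X j) ∘ₗ (pderiv j).toLinearMap ∘ₗ (pderiv j).toLinearMap)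

theorem lower_apply (e : ℕ) (f : MvPolynomial σ k) :
    lower k σ e f = ∑ j, ((e : MvPolynomial σ k) * pderiv j f - X j * pderiv j (pderiv j f)) := by
  simp [lower, LinearMap.sum_apply, nsmul_eq_mul]

theorem lower_X_mul (e : ℕ) (l : σ) (f : MvPolynomial σ k) :
    lower k σ e (X l * f) = X l * lower k σ e f + ((e : MvPolynomial σ k) * f - 2 * (X l * pderiv l f)) := by
  classical
  rw [lower_apply, lower_apply, Finset.mul_sum, ← sub_eq_iff_eq_add', ← Finset.sum_sub_distrib,
    Finset.sum_eq_single l]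
  · simp only [pderiv_mul, pderiv_X_self, map_add, one_mul]
    ring
  · intro j _ hj
    simp only [pderiv_mul, pderiv_X_of_ne hj.symm, zero_mul, zero_add]
    ring
  · simp

/-- The sl₂ commutator: Euler's identity turns the sum of the x_l ∂_l into the degree, leaving the
weight. -/
theorem lower_sumX_mul {e i : ℕ} {f : MvPolynomial σ k} (hf : f.IsHomogeneous i) :
    lower k σ e (sumX k σ * f) =
      sumX k σ * lower k σ e f + ((Fintype.card σ * e : ℕ) - 2 * (i : MvPolynomial σ k)) * f := by
  have h := hf.sum_X_mul_pderiv
  rw [nsmul_eq_mul] at h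
  rw [sumX, Finset.sum_mul, map_sum, Finset.sum_congr rfl fun l _ => lower_X_mul e l f,
    Finset.sum_add_distrib, Finset.sum_sub_distrib, ← Finset.mul_sum, ← Finset.mul_sum, h,
    ← Finset.sum_mul]
  simp only [Finset.sum_const, Finset.card_univ, nsmul_eq_mul]
  push_cast
  ring

theorem isHomogeneous_lower {e i : ℕ} {f : MvPolynomial σ k} (hf : f.IsHomogeneous (i + 1)) :
    (lower k σ e f).IsHomogeneous i := by
  rw [lower_apply]
  refine IsHomogeneous.sum _ _ _ fun j _ => ?_
  have h1 : (pderiv j f).IsHomogeneous i := hf.pderiv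
  refine IsHomogeneous.sub ?_ ?_
  · rw [← map_natCast (C (σ := σ) (R := k))]
    exact h1.C_mul _
  · rcases i with _ | i
    · have : pderiv j (pderiv j f) = 0 := by
        rw [← totalDegree_zero_iff_isHomogeneous, totalDegree_eq_zero_iff_eq_C] at h1
        rw [h1, pderiv_C]
      rw [this, mul_zero]
      exact isHomogeneous_zero _ _ _
    · rw [add_comm]
      exact (isHomogeneous_X _ _).mul h1.pderiv

theorem coeff_lower (e : ℕ) (f : MvPolynomial σ k) (m : σ →₀ ℕ) :
    coeff m (lower k σ e f) =
      ∑ j, (m j + 1 : k) * ((e : k) - m j) * coeff (m + Finsupp.single j 1) f := by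
  classical
  rw [lower_apply, coeff_sum]
  refine Finset.sum_congr rfl fun j _ => ?_
  rw [coeff_sub, ← map_natCast (C (σ := σ) (R := k)), coeff_C_mul, coeff_X_mul', coeff_pderiv]
  split_ifs with h
  · have h1 : m - Finsupp.single j 1 + Finsupp.single j 1 = m := by
      refine tsub_add_cancel_of_le ?_
      rw [Finsupp.single_le_iff]
      exact Nat.one_le_iff_ne_zero.2 (Finsupp.mem_support_iff.1 h)
    have h2 : ((m - Finsupp.single j 1 : σ →₀ ℕ) j : k) + 1 = m j := by
      conv_rhs => rw [← h1]
      simp only [Finsupp.add_apply, Finsupp.single_eq_same]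
      push_cast
      ring
    rw [coeff_pderiv, h1, coeff_pderiv, h2]
    ring
  · have : m j = 0 := by simpa using h
    simp [this]

/-- The only way to leave the ideal is to lower an exponent from e + 1 to e, and there the factor e
- m_j vanishes. -/
theorem lower_mem {e : ℕ} {f : MvPolynomial σ k} (hf : f ∈ monIdeal k (fun _ : σ => e + 1)) :
    lower k σ e f ∈ monIdeal k (fun _ : σ => e + 1) := by
  rw [mem_monIdeal] at hf ⊢
  intro m hm
  rw [coeff_lower]
  refine Finset.sum_eq_zero fun j _ => ?_
  rcases eq_or_ne (m j) e with h | h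
  · simp [h]
  · rw [hf, mul_zero]
    intro l
    have := hm l
    rcases eq_or_ne j l with rfl | hl
    · simp; omega
    · simpa [hl] using this

theorem isHomogeneous_iterate_lower {e i : ℕ} {f : MvPolynomial σ k} (hf : f.IsHomogeneous i)
    {m : ℕ} (hm : m ≤ i) : ((lower k σ e)^[m] f).IsHomogeneous (i - m) := by
  induction m with
  | zero => exact hf
  | succ m ih =>
    rw [Function.iterate_succ_apply']
    refine isHomogeneous_lower ?_
    rw [show i - (m + 1) + 1 = i - m by omega]
    exact ih (by omega)

/-- Apply the lowering operator m + 1 times to L f and move it past L each time. The scalar is the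
sum of the weights met in degrees i, i - 1, ..., i - m. -/
theorem sumX_mul_iterate_lower_mem {e i : ℕ} {f : MvPolynomial σ k} (hf : f.IsHomogeneous i)
    (hL : sumX k σ * f ∈ monIdeal k (fun _ : σ => e + 1)) {m : ℕ} (hm : m ≤ i) :
    sumX k σ * (lower k σ e)^[m + 1] f + C (((m : k) + 1) * ((Fintype.card σ * e : ℕ) - 2 * i + m)) *
      (lower k σ e)^[m] f ∈ monIdeal k (fun _ : σ => e + 1) := by
  induction m with
  | zero =>
    have := lower_mem hL
    rw [lower_sumX_mul hf] at this
    simpa [map_ofNat] using this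
  | succ m ih =>
    have := lower_mem (ih (by omega))
    rw [map_add, lower_sumX_mul (isHomogeneous_iterate_lower hf (by omega)), ← smul_eq_C_mul,
      map_smul, smul_eq_C_mul, ← Function.iterate_succ_apply' (lower k σ e),
      ← Function.iterate_succ_apply' (lower k σ e)] at this
    convert! this using 1
    have hc : ((i - (m + 1) : ℕ) : MvPolynomial σ k) = (i : MvPolynomial σ k) - (m + 1) := by
      rw [Nat.cast_sub hm]; push_cast; ring
    rw [hc]
    simp only [map_mul, map_add, map_sub, map_natCast, map_one, map_ofNat, Nat.cast_add,
      Nat.cast_one, Nat.succ_eq_add_one]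
    ring

theorem sumX_pow_mul_iterate_lower_sub_mem {e i : ℕ} {f : MvPolynomial σ k}
    (hf : f.IsHomogeneous i) (hL : sumX k σ * f ∈ monIdeal k (fun _ : σ => e + 1))
    {m : ℕ} (hm : m ≤ i) :
    sumX k σ ^ m * (lower k σ e)^[m] f -
      C (∏ j ∈ Finset.range m, -(((j : k) + 1) * ((Fintype.card σ * e : ℕ) - 2 * i + j))) * f ∈
      monIdeal k (fun _ : σ => e + 1) := by
  induction m with
  | zero => simp
  | succ m ih =>
    have h1 := (monIdeal k fun _ : σ => e + 1).mul_mem_left (sumX k σ ^ m)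
      (sumX_mul_iterate_lower_mem hf hL (m := m) (by omega))
    have h2 := (monIdeal k fun _ : σ => e + 1).mul_mem_left
      (C (-(((m : k) + 1) * ((Fintype.card σ * e : ℕ) - 2 * i + m)))) (ih (by omega))
    convert! add_mem h1 h2 using 1
    rw [Finset.prod_range_succ]
    simp only [map_mul, map_neg]
    ring

end Lowering

/-! ### Large characteristic: injectivity up to the middle -/

section Injectivity

variable {k : Type*} [Field k] {σ : Type*}

theorem pderiv_mem {a : σ → ℕ} [DecidableEq σ] {f : MvPolynomial σ k} (hf : f ∈ monIdeal k a)
    (j : σ) : pderiv j f ∈ monIdeal k (Function.update a j (a j - 1)) := by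
  rw [mem_monIdeal] at hf ⊢
  intro m hm
  rw [coeff_pderiv, hf, zero_mul]
  intro l
  have := hm l
  rcases eq_or_ne l j with rfl | hl
  · simp at this ⊢; omega
  · simpa [hl, hl.symm] using this

variable [Fintype σ]

/-- Differentiating in a variable with a_j > 1 lowers the power of L by one, at the cost of a factor
prime to p, and lowers a_j by one. -/
theorem sumX_pow_notMem (p : ℕ) [CharP k p] [Fact p.Prime] (e : ℕ) :
    ∀ a : σ → ℕ, (∀ i, 0 < a i) → e ≤ ∑ i, (a i - 1) → e < p → sumX k σ ^ e ∉ monIdeal k a := by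
  classical
  induction e with
  | zero =>
    intro a ha _ _
    rw [pow_zero]
    exact notMem_monIdeal.2 ⟨0, by simpa using ha, by simp⟩
  | succ e ih =>
    intro a ha he hp hmem
    obtain ⟨j, hj⟩ : ∃ j, 0 < a j - 1 := by
      by_contra! h
      rw [Finset.sum_eq_zero fun i _ => Nat.le_zero.1 (h i)] at he
      omega
    have h1 := pderiv_mem hmem j
    have h2 : pderiv j (sumX k σ) = 1 := by
      rw [sumX, map_sum, Finset.sum_eq_single j (fun l _ hl => pderiv_X_of_ne hl) (by simp),
        pderiv_X_self]
    rw [pderiv_pow, h2, mul_one, Nat.add_sub_cancel, ← map_natCast (C (σ := σ) (R := k)),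
      C_mul_mem_iff] at h1
    · refine ih _ (fun i => ?_) ?_ (by omega) h1
      · rcases eq_or_ne i j with rfl | h
        · simpa using hj
        · simpa [h] using ha i
      · rw [← Finset.add_sum_erase _ _ (Finset.mem_univ j)] at he ⊢
        rw [Function.update_self, Finset.sum_congr rfl fun i hi => by
          rw [Function.update_of_ne (Finset.ne_of_mem_erase hi)]]
        omega
    · rw [Ne, CharP.cast_eq_zero_iff k p]
      exact fun h => absurd (Nat.le_of_dvd (by omega) h) (by omega)

variable (k) in
/-- The power sum of exponent `q` kills a nonzero class of degree `e` in the monomial complete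
intersection with exponents `a`. -/
def HasKer (a : σ → ℕ) (q e : ℕ) : Prop :=
  ∃ g : MvPolynomial σ k, g.IsHomogeneous e ∧ g ∉ monIdeal k a ∧
    (∑ j, X j ^ q) * g ∈ monIdeal k a

theorem hasKer_one {a : σ → ℕ} {e : ℕ} : HasKer k a 1 e ↔
    ∃ g : MvPolynomial σ k, g.IsHomogeneous e ∧ g ∉ monIdeal k a ∧ sumX k σ * g ∈ monIdeal k a := by
  simp [HasKer, sumX]

theorem HasKer.lift {d e q : ℕ} (t : ℕ) (h : HasKer k (fun _ : σ => d) q e)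
    (he : e + t ≤ Fintype.card σ * (d - 1)) : HasKer k (fun _ : σ => d) q (t + e) := by
  obtain ⟨g, hg, hgI, hL⟩ := h
  obtain ⟨w, hw, hwg⟩ := exists_mul_notMem t hg hgI he
  refine ⟨w * g, hw.mul hg, hwg, ?_⟩
  rw [mul_left_comm]
  exact Ideal.mul_mem_left _ _ hL

/-- In large characteristic the sum of the variables acts injectively up to the middle degree. -/
theorem not_hasKer (p : ℕ) [CharP k p] [Fact p.Prime] {d e : ℕ} (hd : 0 < d)
    (hp : (Fintype.card σ * (d - 1) + 3) / 2 ≤ p) (he : 2 * e + 1 ≤ Fintype.card σ * (d - 1)) :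
    ¬ HasKer k (fun _ : σ => d) 1 e := by
  intro hker
  obtain ⟨c, rfl⟩ : ∃ c, d = c + 1 := ⟨d - 1, by omega⟩
  simp only [Nat.add_sub_cancel] at hp he
  -- The largest degree strictly below the middle. With this i the hypothesis `hp` says exactly i +
  -- 1 < p, and the weight at i is 1 or 2.
  obtain ⟨i, hi1, hi2, hei⟩ : ∃ i, 2 * i + 1 ≤ Fintype.card σ * c ∧
      Fintype.card σ * c ≤ 2 * i + 2 ∧ e ≤ i :=
    ⟨(Fintype.card σ * c - 1) / 2, by omega, by omega, by omega⟩
  have hker' := hker.lift (i - e) (by simp only [Nat.add_sub_cancel]; omega)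
  rw [show i - e + e = i by omega, hasKer_one] at hker'
  obtain ⟨f, hf, hfI, hL⟩ := hker'
  have key := sumX_pow_mul_iterate_lower_sub_mem hf hL le_rfl
  have hD := isHomogeneous_iterate_lower (e := c) hf le_rfl
  rw [Nat.sub_self, ← totalDegree_zero_iff_isHomogeneous, totalDegree_eq_zero_iff_eq_C] at hD
  rw [hD] at key
  set γ := coeff 0 ((lower k σ c)^[i] f) with hγ
  -- Multiplying `key` by L kills its f-term, so γ L^(i+1) lies in the ideal, while L^(i+1) does
  -- not.
  have hγ0 : γ = 0 := by
    by_contra hne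
    refine sumX_pow_notMem p (i + 1) (fun _ : σ => c + 1) (fun _ => Nat.succ_pos _) ?_ (by omega)
      ((C_mul_mem_iff hne).1 ?_)
    · simp only [Nat.add_sub_cancel, Finset.sum_const, Finset.card_univ, smul_eq_mul]
      omega
    · have h1 := (monIdeal k fun _ : σ => c + 1).mul_mem_left (sumX k σ) key
      have h2 := (monIdeal k fun _ : σ => c + 1).mul_mem_left
        (C (∏ j ∈ Finset.range i, -(((j : k) + 1) * ((Fintype.card σ * c : ℕ) - 2 * i + j)))) hL
      convert! add_mem h1 h2 using 1
      ring
  rw [hγ0, C_0, mul_zero, zero_sub, neg_mem_iff, C_mul_mem_iff] at key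
  · exact hfI key
  · refine Finset.prod_ne_zero_iff.2 fun j hj => neg_ne_zero.2 (mul_ne_zero ?_ ?_)
    all_goals rw [Finset.mem_range] at hj
    · rw [← Nat.cast_succ, Ne, CharP.cast_eq_zero_iff k p]
      exact fun h => absurd (Nat.le_of_dvd (by omega) h) (by omega)
    · have : ((Fintype.card σ * c : ℕ) : k) - 2 * i + j =
          ((Fintype.card σ * c - 2 * i + j : ℕ) : k) := by
        rw [Nat.cast_add, Nat.cast_sub (by omega)]
        push_cast
        ring
      rw [this, Ne, CharP.cast_eq_zero_iff k p]
      exact fun h => absurd (Nat.le_of_dvd (by omega) h) (by omega)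

end Injectivity

/-! ### Building killed classes: tensor products, Frobenius, adjoining a variable -/

section KernelConstructions

variable {k : Type*} [Field k] {σ τ : Type*}

theorem monomial_mem_monIdeal {a : σ → ℕ} {m : σ →₀ ℕ} (c : k) (h : ∃ j, a j ≤ m j) :
    monomial m c ∈ monIdeal k a := by
  classical
  rw [mem_monIdeal]
  intro n hn
  obtain ⟨j, hj⟩ := h
  rw [coeff_monomial, if_neg]
  rintro rfl
  exact absurd (hn j) (not_lt.2 hj)

theorem rename_mem_monIdeal {a : σ → ℕ} {b : τ → ℕ} (f : σ → τ) (h : ∀ i, b (f i) ≤ a i)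
    {g : MvPolynomial σ k} (hg : g ∈ monIdeal k a) : rename f g ∈ monIdeal k b := by
  have : monIdeal k a ≤ (monIdeal k b).comap (rename (R := k) f) := by
    refine Ideal.span_le.2 ?_
    rintro _ ⟨i, rfl⟩
    simpa using X_pow_mem_monIdeal b (f i) (h i)
  exact this hg

theorem coeff_sumElim_mul (g : MvPolynomial σ k) (h : MvPolynomial τ k) (m : σ →₀ ℕ)
    (m' : τ →₀ ℕ) :
    coeff (Finsupp.sumElim m m') (rename Sum.inl g * rename Sum.inr h) =
      coeff m g * coeff m' h := by
  classical
  have key (u : σ →₀ ℕ) (v : τ →₀ ℕ) :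
      Finsupp.mapDomain Sum.inl u + Finsupp.mapDomain Sum.inr v = Finsupp.sumElim u v := by
    ext (i | i)
    · rw [Finsupp.add_apply, Finsupp.mapDomain_apply Sum.inl_injective,
        Finsupp.mapDomain_of_notMem_range _ _ (by simp), Finsupp.sumElim_inl, add_zero]
    · rw [Finsupp.add_apply, Finsupp.mapDomain_apply Sum.inr_injective,
        Finsupp.mapDomain_of_notMem_range _ _ (by simp), Finsupp.sumElim_inr, zero_add]
  induction g using MvPolynomial.induction_on' with
  | add p q hp hq => simp [add_mul, hp, hq]
  | monomial u c =>
    induction h using MvPolynomial.induction_on' with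
    | add p q hp hq => simp [mul_add, hp, hq]
    | monomial v c' =>
      have : Finsupp.sumElim u v = Finsupp.sumElim m m' ↔ u = m ∧ v = m' := by
        refine ⟨fun h => ⟨?_, ?_⟩, fun h => by rw [h.1, h.2]⟩
        · ext i; simpa using DFunLike.congr_fun h (Sum.inl i)
        · ext i; simpa using DFunLike.congr_fun h (Sum.inr i)
      rw [rename_monomial, rename_monomial, monomial_mul, key]
      simp only [coeff_monomial, this]
      split_ifs <;> simp_all

variable [Fintype σ] [Fintype τ]

/-- On a tensor product the power sum acts as the sum of its two parts, each of which kills one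
factor of g ⊗ g'. -/
theorem HasKer.sum {a : σ → ℕ} {b : τ → ℕ} {q e e' : ℕ} (h : HasKer k a q e)
    (h' : HasKer k b q e') : HasKer k (Sum.elim a b) q (e + e') := by
  obtain ⟨g, hg, hgI, hL⟩ := h
  obtain ⟨g', hg', hgI', hL'⟩ := h'
  obtain ⟨m, hm, hc⟩ := notMem_monIdeal.1 hgI
  obtain ⟨m', hm', hc'⟩ := notMem_monIdeal.1 hgI'
  refine ⟨rename Sum.inl g * rename Sum.inr g', hg.rename_isHomogeneous.mul
    hg'.rename_isHomogeneous, notMem_monIdeal.2 ⟨Finsupp.sumElim m m', ?_, ?_⟩, ?_⟩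
  · rintro (i | i)
    · exact hm i
    · exact hm' i
  · rw [coeff_sumElim_mul]
    exact mul_ne_zero hc hc'
  · have h1 := rename_mem_monIdeal (b := Sum.elim a b) Sum.inl (fun i => le_rfl) hL
    have h2 := rename_mem_monIdeal (b := Sum.elim a b) Sum.inr (fun i => le_rfl) hL'
    rw [Fintype.sum_sum_type]
    simp only [map_mul, map_sum, map_pow, rename_X] at h1 h2
    convert! add_mem (Ideal.mul_mem_right (rename Sum.inr g') _ h1)
      (Ideal.mul_mem_left _ (rename Sum.inl g) h2) using 1
    ring

theorem HasKer.congr {d q e : ℕ} (φ : σ ≃ τ) (h : HasKer k (fun _ : σ => d) q e) :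
    HasKer k (fun _ : τ => d) q e := by
  obtain ⟨g, hg, hgI, hL⟩ := h
  refine ⟨rename φ g, hg.rename_isHomogeneous, fun hmem => hgI ?_, ?_⟩
  · have := rename_mem_monIdeal (b := fun _ : σ => d) φ.symm (fun i => le_rfl) hmem
    simpa [rename_rename] using this
  · have := rename_mem_monIdeal (b := fun _ : τ => d) φ (fun i => le_rfl) hL
    simp only [map_mul, map_sum, map_pow, rename_X] at this
    rwa [Fintype.sum_equiv φ _ (fun j => X j ^ q) fun i => rfl] at this

theorem HasKer.sum_const {d q e e' : ℕ} {ι : Type*} [Fintype ι] (h : HasKer k (fun _ : σ => d) q e)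
    (h' : HasKer k (fun _ : τ => d) q e')
    (hι : Fintype.card ι = Fintype.card σ + Fintype.card τ) :
    HasKer k (fun _ : ι => d) q (e + e') := by
  have := h.sum h'
  have hd : Sum.elim (fun _ : σ => d) (fun _ : τ => d) = fun _ => d := by
    ext (i | i) <;> rfl
  rw [hd] at this
  exact this.congr (Fintype.equivOfCardEq (by simp [hι]))

/-- Pulling a kernel element back along a power of Frobenius. -/
theorem HasKer.expand {a d ρ : σ → ℕ} {q e : ℕ} (hq : 0 < q) (h : HasKer k a 1 e)
    (h1 : ∀ i, d i ≤ q * a i + ρ i) (h2 : ∀ i, q * (a i - 1) + ρ i < d i) :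
    HasKer k d q (q * e + ∑ i, ρ i) := by
  classical
  obtain ⟨g, hg, hgI, hL⟩ := hasKer_one.1 h
  obtain ⟨m, hm, hc⟩ := notMem_monIdeal.1 hgI
  set r : σ →₀ ℕ := Finsupp.equivFunOnFinite.symm ρ with hr
  have hri (i : σ) : r i = ρ i := rfl
  refine ⟨monomial r 1 * MvPolynomial.expand q g, ?_, ?_, ?_⟩
  · rw [add_comm]
    refine IsHomogeneous.mul (isHomogeneous_monomial _ (by simp [Finsupp.degree_eq_sum, hri])) ?_
    exact hg.aeval (S := k) (fun i : σ => (X i) ^ q) fun i => isHomogeneous_X_pow i q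
  · refine notMem_monIdeal.2 ⟨r + q • m, fun i => ?_, ?_⟩
    · refine lt_of_le_of_lt ?_ (h2 i)
      have : q * m i ≤ q * (a i - 1) := Nat.mul_le_mul_left _ (Nat.le_sub_one_of_lt (hm i))
      simp only [Finsupp.add_apply, hri, Finsupp.smul_apply, smul_eq_mul]
      omega
    · rwa [coeff_monomial_mul, one_mul, coeff_expand_smul _ hq.ne']
  · have key : ∀ f ∈ monIdeal k a, monomial r 1 * MvPolynomial.expand q f ∈ monIdeal k d := by
      intro f hf
      induction hf using Submodule.span_induction with
      | zero => simp
      | add x y _ _ hx hy => rw [map_add, mul_add]; exact add_mem hx hy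
      | smul c x _ hx =>
        rw [smul_eq_mul, map_mul, mul_left_comm]
        exact Ideal.mul_mem_left _ _ hx
      | mem x hx =>
        obtain ⟨i, rfl⟩ := hx
        rw [map_pow, expand_X, ← pow_mul, X_pow_eq_monomial, monomial_mul]
        refine monomial_mem_monIdeal _ ⟨i, (h1 i).trans ?_⟩
        simp [hri, add_comm]
    have := key _ hL
    rw [map_mul, sumX, map_sum] at this
    simp only [expand_X] at this
    rwa [mul_left_comm] at this

/-- In characteristic p the power sum is L^(p^s). The last nonzero class among g, L g, L² g, ... is
killed by L, and fewer than p^s factors have been used. -/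
theorem HasKer.of_pow_char (p s : ℕ) [CharP k p] [Fact p.Prime] {a : σ → ℕ} {e : ℕ}
    (h : HasKer k a (p ^ s) e) : ∃ e', e' + 1 ≤ e + p ^ s ∧ HasKer k a 1 e' := by
  classical
  obtain ⟨g, hg, hgI, hL⟩ := h
  have : CharP (MvPolynomial σ k) p := inferInstance
  have : ExpChar (MvPolynomial σ k) p := ExpChar.prime Fact.out
  rw [← sum_pow_char_pow] at hL
  have hex : ∃ t, sumX k σ ^ t * g ∈ monIdeal k a := ⟨p ^ s, hL⟩
  have hle : Nat.find hex ≤ p ^ s := Nat.find_min' hex hL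
  have hspec := Nat.find_spec hex
  obtain ⟨t, ht⟩ : ∃ t, Nat.find hex = t + 1 := by
    refine Nat.exists_eq_succ_of_ne_zero fun h0 => hgI ?_
    rw [h0, pow_zero, one_mul] at hspec
    exact hspec
  refine ⟨t + e, by omega, hasKer_one.2 ⟨sumX k σ ^ t * g, ?_, Nat.find_min hex (by omega), ?_⟩⟩
  · exact IsHomogeneous.mul (by simpa using isHomogeneous_sumX.pow t) hg
  · rwa [← mul_assoc, ← pow_succ', ← ht]

theorem coeff_cons_X_pow_mul_rename {N : ℕ} (i t : ℕ) (g : MvPolynomial (Fin N) k)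
    (m : Fin N →₀ ℕ) : coeff (Finsupp.cons t m) (X 0 ^ i * rename Fin.succ g) =
      if t = i then coeff m g else 0 := by
  have h : finSuccEquiv k N (rename Fin.succ g) = Polynomial.C g := by
    induction g using MvPolynomial.induction_on with
    | C c => simp [finSuccEquiv_apply]
    | add p q hp hq => simp only [map_add, hp, hq]
    | mul_X p j hp => rw [map_mul, map_mul, hp, rename_X, finSuccEquiv_X_succ, map_mul]
  rw [← finSuccEquiv_coeff_coeff, map_mul, map_pow, finSuccEquiv_X_zero, h,
    mul_comm, Polynomial.coeff_C_mul_X_pow]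
  split_ifs <;> simp

/-- A class killed by a power of the sum of the variables gives a class killed by the sum of the
variables after adjoining one more variable. -/
theorem hasKer_cons {N b m : ℕ} (hb : 0 < b) {a : Fin N → ℕ} {w : MvPolynomial (Fin N) k}
    (hw : w.IsHomogeneous m) (hwI : w ∉ monIdeal k a)
    (hL : sumX k (Fin N) ^ b * w ∈ monIdeal k a) :
    HasKer k (Fin.cons b a : Fin (N + 1) → ℕ) 1 (b - 1 + m) := by
  obtain ⟨n, hn, hc⟩ := notMem_monIdeal.1 hwI
  set ℓ := sumX k (Fin N) with hℓ
  -- The class is w (x_0^b - (-ℓ)^b) / (x_0 + ℓ). Multiplying by x_0 + ℓ leaves two terms, both in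
  -- the ideal; the coefficient of x_0^(b-1) is w, so the class is nonzero.
  have hF : (∑ i ∈ Finset.range b, X 0 ^ i * (-(rename Fin.succ ℓ : MvPolynomial (Fin (N + 1)) k))
      ^ (b - 1 - i)) * rename Fin.succ w =
      ∑ i ∈ Finset.range b, X 0 ^ i * rename Fin.succ ((-ℓ) ^ (b - 1 - i) * w) := by
    rw [Finset.sum_mul]
    exact Finset.sum_congr rfl fun i _ => by simp [mul_assoc]
  refine hasKer_one.2
    ⟨∑ i ∈ Finset.range b, X 0 ^ i * rename Fin.succ ((-ℓ) ^ (b - 1 - i) * w), ?_, ?_, ?_⟩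
  · refine IsHomogeneous.sum _ _ _ fun i hi => ?_
    have h1 : ((-ℓ) ^ (b - 1 - i)).IsHomogeneous (b - 1 - i) := by
      simpa using isHomogeneous_sumX.neg.pow (b - 1 - i)
    convert! (isHomogeneous_X_pow (0 : Fin (N + 1)) i).mul
      (h1.mul hw).rename_isHomogeneous using 1
    rw [Finset.mem_range] at hi
    omega
  · refine notMem_monIdeal.2 ⟨Finsupp.cons (b - 1) n, fun i => ?_, ?_⟩
    · refine Fin.cases ?_ (fun i => ?_) i
      · simpa using hb
      · simpa using hn i
    · rw [coeff_sum, Finset.sum_eq_single (b - 1), coeff_cons_X_pow_mul_rename, if_pos rfl]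
      · simpa using hc
      · intro i _ hi
        rw [coeff_cons_X_pow_mul_rename, if_neg hi.symm]
      · intro h
        exact absurd (Finset.mem_range.2 (by omega)) h
  · have hsum : sumX k (Fin (N + 1)) = X 0 - -(rename Fin.succ ℓ) := by
      rw [sumX, Fin.sum_univ_succ, hℓ, sumX, map_sum, sub_neg_eq_add]
      simp
    rw [← hF, ← mul_assoc, hsum, mul_comm (_ - _), geom_sum₂_mul, sub_mul, neg_pow, mul_assoc,
      ← map_pow, ← map_mul]
    refine sub_mem (Ideal.mul_mem_right _ _ (X_pow_mem_monIdeal _ _ (by simp)))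
      (Ideal.mul_mem_left _ _ (rename_mem_monIdeal _ (fun i => by simp) hL))

/-- A dimension count in two variables. -/
theorem exists_sum_pow_mul_mem {b c m : ℕ} (hm : m < c) (hb : 2 * c ≤ 2 * m + b + 1) :
    ∃ w : MvPolynomial (Fin 2) k, w.IsHomogeneous m ∧ w ∉ monIdeal k (fun _ : Fin 2 => c) ∧
      sumX k (Fin 2) ^ b * w ∈ monIdeal k (fun _ : Fin 2 => c) := by
  classical
  let ex (i j : ℕ) : Fin 2 →₀ ℕ := Finsupp.equivFunOnFinite.symm ![i, j]
  have hex (i j i' j' : ℕ) : ex i j = ex i' j' ↔ i = i' ∧ j = j' := by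
    refine ⟨fun h => ⟨?_, ?_⟩, fun h => by rw [h.1, h.2]⟩
    · simpa [ex] using DFunLike.congr_fun h 0
    · simpa [ex] using DFunLike.congr_fun h 1
  let W : (Fin (m + 1) → k) →ₗ[k] MvPolynomial (Fin 2) k :=
    ∑ i : Fin (m + 1), monomial (ex i (m - i)) ∘ₗ LinearMap.proj i
  -- There are m + 1 unknown coefficients, while at most 2c - 1 - m - b ≤ m monomials of degree m +
  -- b survive modulo (x^c, y^c). Indexing by `Fin m` may list harmless extra conditions.
  let T : (Fin (m + 1) → k) →ₗ[k] (Fin m → k) := LinearMap.pi fun t : Fin m =>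
    lcoeff k (ex (m + b + 1 - c + t) (c - 1 - t)) ∘ₗ
      LinearMap.mulLeft k (sumX k (Fin 2) ^ b) ∘ₗ W
  have hT : LinearMap.ker T ≠ ⊥ := LinearMap.ker_ne_bot_of_finrank_lt (by simp)
  obtain ⟨v, hv, hv0⟩ := Submodule.exists_mem_ne_zero_of_ne_bot hT
  have hW : W v = ∑ i : Fin (m + 1), monomial (ex i (m - i)) (v i) := by
    simp [W, LinearMap.sum_apply]
  have hhom : (W v).IsHomogeneous m := by
    rw [hW]
    refine IsHomogeneous.sum _ _ _ fun i _ => isHomogeneous_monomial _ ?_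
    simp [Finsupp.degree_eq_sum, ex, Fin.sum_univ_two]
    omega
  refine ⟨W v, hhom, ?_, ?_⟩
  · obtain ⟨i, hi⟩ := Function.ne_iff.1 hv0
    refine notMem_monIdeal.2 ⟨ex i (m - i), ?_, ?_⟩
    · rw [Fin.forall_fin_two]
      simp [ex]
      omega
    · rw [hW, coeff_sum, Finset.sum_eq_single i]
      · simpa using hi
      · intro j _ hj
        rw [coeff_monomial, if_neg]
        rw [hex]
        exact fun h => hj (Fin.ext h.1)
      · simp
  · rw [mem_monIdeal]
    intro n hn
    by_contra hc
    have hdeg := coeff_ne_zero_degree ((isHomogeneous_sumX.pow b).mul hhom) hc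
    rw [Finsupp.degree_eq_sum, Fin.sum_univ_two] at hdeg
    have h0 := hn 0
    have h1 := hn 1
    have := congrFun (LinearMap.mem_ker.1 hv) ⟨n 0 - (m + b + 1 - c), by omega⟩
    refine hc ?_
    have hn' : n = ex (m + b + 1 - c + (n 0 - (m + b + 1 - c)))
        (c - 1 - (n 0 - (m + b + 1 - c))) := by
      ext i
      fin_cases i
      · simp [ex]; omega
      · simp [ex]; omega
    rw [hn']
    simpa [T] using this

theorem hasKer_pair {c : ℕ} (hc : 0 < c) : HasKer k (fun _ : Fin 2 => c) 1 (c - 1) := by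
  obtain ⟨w, hw, hwI, hL⟩ := exists_sum_pow_mul_mem (k := k) (b := 1) (c := c) (m := c - 1)
    (by omega) (by omega)
  exact hasKer_one.2 ⟨w, hw, hwI, by simpa using hL⟩

theorem hasKer_triple {b c m : ℕ} (hb : 0 < b) (hm : m < c) (h : 2 * c ≤ 2 * m + b + 1) :
    HasKer k (Fin.cons b fun _ : Fin 2 => c : Fin 3 → ℕ) 1 (b - 1 + m) := by
  obtain ⟨w, hw, hwI, hL⟩ := exists_sum_pow_mul_mem (k := k) hm h
  exact hasKer_cons hb hw hwI hL

end KernelConstructions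

/-! ### Small characteristic: killed classes below the middle -/

section SmallCharacteristic

variable {k : Type*} [Field k]

theorem hasKer_zero {σ : Type*} [Fintype σ] {d q : ℕ} (hd : 0 < d) (hq : d ≤ q) :
    HasKer k (fun _ : σ => d) q 0 := by
  refine ⟨1, isHomogeneous_one _ _, notMem_monIdeal.2 ⟨0, fun _ => hd, by simp⟩, ?_⟩
  rw [mul_one]
  exact Ideal.sum_mem _ fun i _ => X_pow_mem_monIdeal _ i hq

/-- Round d/q down and let the monomial (xy)^r absorb the remainder. -/
theorem hasKer_pair_add {d q u r : ℕ} (hq : 0 < q) (hd : d = q * (u + 1) + r) :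
    HasKer k (fun _ : Fin 2 => d) q (q * u + 2 * r) := by
  have := (hasKer_pair (k := k) (c := u + 1) (by omega)).expand (d := fun _ => d)
    (ρ := fun _ => r) hq (fun _ => hd.le) (fun _ => by
      rw [hd, Nat.add_sub_cancel, mul_add]; omega)
  simpa using this

/-- Round d/q up, with no monomial factor. This beats rounding down exactly when q < 2r. -/
theorem hasKer_pair_of_pos {d q u r : ℕ} (hr : 0 < r) (hrq : r < q) (hd : d = q * (u + 1) + r) :
    HasKer k (fun _ : Fin 2 => d) q (q * (u + 1)) := by
  have := (hasKer_pair (k := k) (c := u + 2) (by omega)).expand (d := fun _ => d)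
    (ρ := fun _ => 0) (q := q) (by omega) (fun _ => by simp only [hd, mul_add]; omega)
    (fun _ => by simp only [hd]; rw [show u + 2 - 1 = u + 1 by omega]; omega)
  simpa using this

theorem hasKer_triple_add {d q b c m r s : ℕ} (hq : 0 < q) (hm : m < c)
    (h : 2 * c ≤ 2 * m + b + 2) (hb1 : d ≤ q * (b + 1) + r) (hb2 : q * b + r < d)
    (hc1 : d ≤ q * c + s) (hc2 : q * (c - 1) + s < d) :
    HasKer k (fun _ : Fin 3 => d) q (q * b + q * m + (r + 2 * s)) := by
  have := (hasKer_triple (k := k) (b := b + 1) (by omega) hm (by omega)).expand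
    (d := fun _ => d) (ρ := Fin.cons r fun _ => s) hq (fun i => ?_) (fun i => ?_)
  · simpa [Fin.sum_univ_succ, mul_add, two_mul] using this
  · refine Fin.cases ?_ (fun i => ?_) i
    · simpa using hb1
    · simpa using hc1
  · refine Fin.cases ?_ (fun i => ?_) i
    · simpa using hb2
    · simpa using hc2

/-- A pair plus a triple. The first reduced exponent of the triple is the odd number 2v + 1, so m =
c - 1 - v meets the dimension count exactly and the reduced class sits in its middle degree. Each
alternative in `h` is the final degree bound worked out for one choice of roundings. -/
theorem hasKer_five_odd {d q v r : ℕ} (hrq : r < q) (hd : d = q * (2 * v + 1) + r)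
    (h : 5 * r + 4 ≤ 3 * q ∨ r + 4 ≤ q ∨ q + 4 ≤ 3 * r) :
    ∃ e, HasKer k (fun _ : Fin 5 => d) q e ∧ 2 * e + 2 * q ≤ 5 * (d - 1) + 1 := by
  have hq : 0 < q := by omega
  rcases Nat.eq_zero_or_pos r with rfl | hr
  · refine ⟨_, (hasKer_pair_add hq hd).sum_const
      (hasKer_triple_add (d := d) (b := 2 * v) (c := 2 * v + 1) (m := v) (r := 0) (s := 0) hq
        ?_ ?_ ?_ ?_ ?_ ?_) rfl, ?_⟩
    all_goals try simp only [Nat.add_sub_cancel]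
    all_goals simp only [mul_add, mul_one, Nat.mul_left_comm q 2] at hd ⊢; omega
  by_cases h1 : 5 * r + 4 ≤ 3 * q
  · refine ⟨_, (hasKer_pair_add hq hd).sum_const
      (hasKer_triple_add (d := d) (b := 2 * v) (c := 2 * v + 1) (m := v) (r := r) (s := r) hq
        ?_ ?_ ?_ ?_ ?_ ?_) rfl, ?_⟩
    all_goals try simp only [Nat.add_sub_cancel]
    all_goals simp only [mul_add, mul_one, Nat.mul_left_comm q 2] at hd ⊢; omega
  by_cases h2 : r + 4 ≤ q
  · refine ⟨_, (hasKer_pair_of_pos hr hrq hd).sum_const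
      (hasKer_triple_add (d := d) (b := 2 * v) (c := 2 * v + 1) (m := v) (r := r) (s := r) hq
        ?_ ?_ ?_ ?_ ?_ ?_) rfl, ?_⟩
    all_goals try simp only [Nat.add_sub_cancel]
    all_goals simp only [mul_add, mul_one, Nat.mul_left_comm q 2] at hd ⊢; omega
  · refine ⟨_, (hasKer_pair_of_pos hr hrq hd).sum_const
      (hasKer_triple_add (d := d) (b := 2 * v) (c := 2 * v + 2) (m := v + 1) (r := r) (s := 0) hq
        ?_ ?_ ?_ ?_ ?_ ?_) rfl, ?_⟩
    all_goals try rw [show 2 * v + 2 - 1 = 2 * v + 1 by omega]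
    all_goals simp only [mul_add, mul_one, Nat.mul_left_comm q 2] at hd ⊢; omega

/-- Here the first exponent of the triple is rounded up to the odd number 2v + 3. When r = 0 there
is no such choice and half a degree is lost in the reduced triple, which 1 < q absorbs. -/
theorem hasKer_five_even {d q v r : ℕ} (hq2 : 1 < q) (hrq : r < q)
    (hd : d = q * (2 * v + 2) + r)
    (h : r = 0 ∨ 3 * r + 4 ≤ 2 * q ∨ 4 ≤ r ∨ 2 * q + 4 ≤ 5 * r) :
    ∃ e, HasKer k (fun _ : Fin 5 => d) q e ∧ 2 * e + 2 * q ≤ 5 * (d - 1) + 1 := by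
  have hq : 0 < q := by omega
  rcases Nat.eq_zero_or_pos r with rfl | hr
  · refine ⟨_, (hasKer_pair_add (u := 2 * v + 1) hq hd).sum_const
      (hasKer_triple_add (d := d) (b := 2 * v + 1) (c := 2 * v + 2) (m := v + 1) (r := 0) (s := 0)
        hq ?_ ?_ ?_ ?_ ?_ ?_) rfl, ?_⟩
    all_goals try rw [show 2 * v + 2 - 1 = 2 * v + 1 by omega]
    all_goals simp only [mul_add, mul_one, Nat.mul_left_comm q 2] at hd ⊢; omega
  by_cases h1 : 3 * r + 4 ≤ 2 * q
  · refine ⟨_, (hasKer_pair_add (u := 2 * v + 1) hq hd).sum_const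
      (hasKer_triple_add (d := d) (b := 2 * v + 2) (c := 2 * v + 2) (m := v) (r := 0) (s := r)
        hq ?_ ?_ ?_ ?_ ?_ ?_) rfl, ?_⟩
    all_goals try rw [show 2 * v + 2 - 1 = 2 * v + 1 by omega]
    all_goals simp only [mul_add, mul_one, Nat.mul_left_comm q 2] at hd ⊢; omega
  by_cases h2 : 4 ≤ r
  · refine ⟨_, (hasKer_pair_of_pos (u := 2 * v + 1) hr hrq hd).sum_const
      (hasKer_triple_add (d := d) (b := 2 * v + 2) (c := 2 * v + 2) (m := v) (r := 0) (s := r)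
        hq ?_ ?_ ?_ ?_ ?_ ?_) rfl, ?_⟩
    all_goals try rw [show 2 * v + 2 - 1 = 2 * v + 1 by omega]
    all_goals simp only [mul_add, mul_one, Nat.mul_left_comm q 2] at hd ⊢; omega
  · refine ⟨_, (hasKer_pair_of_pos (u := 2 * v + 1) hr hrq hd).sum_const
      (hasKer_triple_add (d := d) (b := 2 * v + 2) (c := 2 * v + 3) (m := v + 1) (r := 0) (s := 0)
        hq ?_ ?_ ?_ ?_ ?_ ?_) rfl, ?_⟩
    all_goals try rw [show 2 * v + 3 - 1 = 2 * v + 2 by omega]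
    all_goals simp only [mul_add, mul_one, Nat.mul_left_comm q 2, Nat.mul_comm q 3] at hd ⊢; omega

/-- Three pairs, of which zero to three are rounded up; the alternatives in `h` are the degree
bounds in these four cases. -/
theorem hasKer_six {d q u r : ℕ} (hrq : r < q) (hd : d = q * (u + 1) + r)
    (h : 6 * r + 5 ≤ 4 * q ∨ 2 * r + 5 ≤ 2 * q ∨ 5 ≤ 2 * r ∨ 2 * q + 5 ≤ 6 * r) :
    ∃ e, HasKer k (fun _ : Fin 6 => d) q e ∧ 2 * e + 2 * q ≤ 6 * (d - 1) + 1 := by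
  have hq : 0 < q := by omega
  have hA := hasKer_pair_add (k := k) hq hd
  by_cases h1 : 6 * r + 5 ≤ 4 * q
  · refine ⟨_, hA.sum_const (hA.sum_const hA (ι := Fin 4) rfl) rfl, ?_⟩
    simp only [mul_add, mul_one] at hd ⊢; omega
  have hB := hasKer_pair_of_pos (k := k) (by omega) hrq hd
  by_cases h2 : 2 * r + 5 ≤ 2 * q
  · refine ⟨_, hA.sum_const (hA.sum_const hB (ι := Fin 4) rfl) rfl, ?_⟩
    simp only [mul_add, mul_one] at hd ⊢; omega
  by_cases h3 : 5 ≤ 2 * r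
  · refine ⟨_, hA.sum_const (hB.sum_const hB (ι := Fin 4) rfl) rfl, ?_⟩
    simp only [mul_add, mul_one] at hd ⊢; omega
  · refine ⟨_, hB.sum_const (hB.sum_const hB (ι := Fin 4) rfl) rfl, ?_⟩
    simp only [mul_add, mul_one] at hd ⊢; omega

variable (p : ℕ) [CharP k p] [hp : Fact p.Prime]

theorem exists_hasKer_of_pow {σ : Type*} [Fintype σ] {d e M : ℕ} (s : ℕ)
    (h : HasKer k (fun _ : σ => d) (p ^ s) e) (he : 2 * e + 2 * p ^ s ≤ M + 1) :
    ∃ e, 2 * e + 1 ≤ M ∧ HasKer k (fun _ : σ => d) 1 e := by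
  obtain ⟨e', he', h'⟩ := h.of_pow_char p s
  exact ⟨e', by omega, h'⟩

theorem exists_pow_decomposition (p : ℕ) [hp : Fact p.Prime] {d : ℕ} (hd : p < d) : ∃ s u r, 0 < s ∧ r < p ^ s ∧
    d = p ^ s * (u + 1) + r ∧ u + 1 < p ∧ d ≤ p ^ (s + 1) := by
  have hp1 := hp.out.one_lt
  have hs : Nat.log p d ≠ 0 := by
    have := Nat.log_pos hp1 hd.le
    omega
  have h1 : p ^ Nat.log p d ≤ d := Nat.pow_log_le_self p (by omega)
  have h2 : d < p ^ (Nat.log p d + 1) := Nat.lt_pow_succ_log_self hp1 d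
  have hpos : 0 < p ^ Nat.log p d := by positivity
  have h3 : 0 < d / p ^ Nat.log p d := Nat.div_pos h1 hpos
  have h4 : d / p ^ Nat.log p d < p := by
    rw [Nat.div_lt_iff_lt_mul hpos, ← pow_succ']
    exact h2
  refine ⟨Nat.log p d, d / p ^ Nat.log p d - 1, d % p ^ Nat.log p d, Nat.pos_of_ne_zero hs,
    Nat.mod_lt _ hpos, ?_, by omega, h2.le⟩
  rw [Nat.sub_add_cancel h3, Nat.div_add_mod]

theorem exists_hasKer_five {d : ℕ} (hd : p < d) :
    ∃ e, 2 * e + 1 ≤ 5 * (d - 1) ∧ HasKer k (fun _ : Fin 5 => d) 1 e := by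
  obtain ⟨s, u, r, hs, hr, hdq, hu, hle⟩ := exists_pow_decomposition p hd
  -- If p^(s+1) is not too large, the class of 1 already works at the next Frobenius level. This
  -- settles p = 2 and the cases of p = 3 that the pair-plus-triple classes miss.
  have hbig : 2 * p ^ (s + 1) ≤ 5 * (d - 1) + 1 →
      ∃ e, 2 * e + 1 ≤ 5 * (d - 1) ∧ HasKer k (fun _ : Fin 5 => d) 1 e := fun h =>
    exists_hasKer_of_pow p (s + 1) (hasKer_zero (by omega) hle) (by omega)
  suffices h : 2 * p ^ (s + 1) ≤ 5 * (d - 1) + 1 ∨ ∃ e, HasKer k (fun _ : Fin 5 => d) (p ^ s) e ∧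
      2 * e + 2 * p ^ s ≤ 5 * (d - 1) + 1 by
    rcases h with h | ⟨e, he, h⟩
    · exact hbig h
    · exact exists_hasKer_of_pow p s he h
  have hpq : p ≤ p ^ s := Nat.le_self_pow hs.ne' p
  rw [pow_succ']
  rcases hp.out.eq_two_or_odd' with rfl | hodd
  · left
    obtain rfl : u = 0 := by omega
    rw [zero_add, mul_one] at hdq
    obtain ⟨t, rfl⟩ := Nat.exists_eq_succ_of_ne_zero hs.ne'
    rw [Nat.succ_eq_add_one, pow_succ] at *
    generalize 2 ^ t = q at *
    omega
  · have hqodd : Odd (p ^ s) := hodd.pow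
    set q := p ^ s with hq
    clear_value q
    obtain ⟨a, ha⟩ := hodd
    obtain ⟨b, hb⟩ := hqodd
    have hp1 := hp.out.one_lt
    rcases Nat.even_or_odd' u with ⟨v, rfl | rfl⟩
    · by_cases h3 : p = 3
      · subst h3
        obtain rfl : v = 0 := by omega
        rw [mul_zero, zero_add, mul_one] at hdq
        by_cases h5 : q + 4 ≤ 5 * r
        · left; omega
        · right
          refine hasKer_five_odd (v := 0) hr (by simpa using hdq) ?_
          have : q = 3 ∨ 5 ≤ q := by omega
          rcases this with rfl | h7 <;> omega
      · right
        refine hasKer_five_odd hr hdq ?_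
        have : q = 5 ∨ 7 ≤ q := by omega
        rcases this with rfl | h7 <;> omega
    · by_cases h3 : p = 3
      · subst h3
        obtain rfl : v = 0 := by omega
        left; omega
      · right
        refine hasKer_five_even (by omega) hr hdq ?_
        have : q = 5 ∨ 7 ≤ q := by omega
        rcases this with rfl | h7 <;> omega

theorem exists_hasKer_six {d : ℕ} (hd : p < d) :
    ∃ e, 2 * e + 1 ≤ 6 * (d - 1) ∧ HasKer k (fun _ : Fin 6 => d) 1 e := by
  obtain ⟨s, u, r, hs, hr, hdq, hu, hle⟩ := exists_pow_decomposition p hd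
  have hpq : p ≤ p ^ s := Nat.le_self_pow hs.ne' p
  rcases hp.out.eq_two_or_odd' with rfl | hodd
  · refine exists_hasKer_of_pow 2 (s + 1) (hasKer_zero (by omega) hle) ?_
    obtain rfl : u = 0 := by omega
    rw [pow_succ']
    rw [zero_add, mul_one] at hdq
    generalize 2 ^ s = q at *
    omega
  · obtain ⟨b, hb⟩ : Odd (p ^ s) := hodd.pow
    obtain ⟨a, ha⟩ := hodd
    have hp1 := hp.out.one_lt
    obtain ⟨e, he, h⟩ := hasKer_six (k := k) hr hdq (by
      have : p ^ s = 3 ∨ 5 ≤ p ^ s := by omega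
      rcases this with h3 | h5 <;> omega)
    exact exists_hasKer_of_pow p s he h

/-- In small characteristic the sum of the variables fails to act injectively in some degree below
the middle. -/
theorem exists_hasKer {n d : ℕ} (hn : 5 ≤ n) (hd : 0 < d) (h : p < (n * (d - 1) + 3) / 2) :
    ∃ e, 2 * e + 1 ≤ n * (d - 1) ∧ HasKer k (fun _ : Fin n => d) 1 e := by
  rcases le_or_gt d p with hdp | hdp
  · refine exists_hasKer_of_pow p 1 (hasKer_zero hd (by simpa using hdp)) ?_
    rw [pow_one]
    omega
  -- For p < d there is always a killed class, so the bound on p, which would not survive n ↦ n - 2,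
  -- is dropped. The removed pair returns in its middle degree d - 1.
  · clear h
    induction n using Nat.strong_induction_on with
    | _ n ih =>
      rcases Nat.lt_or_ge n 7 with h7 | h7
      · obtain rfl | rfl : n = 5 ∨ n = 6 := by omega
        · exact exists_hasKer_five p hdp
        · exact exists_hasKer_six p hdp
      · obtain ⟨e, he, hker⟩ := ih (n - 2) (by omega) (by omega)
        refine ⟨e + (d - 1), ?_, hker.sum_const (hasKer_pair hd) (by simp; omega)⟩
        obtain ⟨m, rfl⟩ : ∃ m, n = m + 2 := ⟨n - 2, by omega⟩
        rw [Nat.add_sub_cancel] at he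
        rw [add_mul]
        omega

end SmallCharacteristic

/-! ### Koszul relations and regular families -/

section Koszul

variable {R ι κ : Type*} [CommRing R] [LinearOrder ι]

/-- The span of the Koszul relations on a family of ring elements. -/
def koszulSpan (g : ι → R) : Submodule R (ι → R) :=
  Submodule.span R {v | ∃ i j : ι, i < j ∧ v = Pi.single i (g j) - Pi.single j (g i)}

theorem single_sub_single_mem_koszulSpan (g : ι → R) (i j : ι) :
    (Pi.single i (g j) - Pi.single j (g i) : ι → R) ∈ koszulSpan g := by
  rcases lt_trichotomy i j with h | rfl | h
  · exact Submodule.subset_span ⟨i, j, h, rfl⟩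
  · simp
  · rw [← neg_sub]
    exact neg_mem (Submodule.subset_span ⟨j, i, h, rfl⟩)

theorem koszulSpan_le_ker [Fintype ι] (g : ι → R) :
    koszulSpan g ≤ LinearMap.ker (Fintype.linearCombination R g) := by
  refine Submodule.span_le.2 ?_
  rintro v ⟨i, j, -, rfl⟩
  simp [Fintype.linearCombination_apply_single, mul_comm]

/-- Koszul relations trade an entry at a that lies in the ideal of the g (f j) for changes at the
positions f j only. -/
theorem exists_sub_mem_koszulSpan {g : ι → R} (f : κ → ι) (S : Finset κ) {a : ι}
    (ha : ∀ j ∈ S, f j ≠ a) {h : ι → R} (hh : h a ∈ Ideal.span ((fun j => g (f j)) '' S)) :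
    ∃ h' : ι → R, h - h' ∈ koszulSpan g ∧ h' a = 0 ∧
      ∀ i, i ≠ a → (∀ j ∈ S, f j ≠ i) → h' i = h i := by
  obtain ⟨c, hc⟩ := (Submodule.mem_span_image_finset_iff_exists_fun R).1 hh
  have key (i : ι) : (∑ j : S, c j • (Pi.single a (g (f j)) - Pi.single (f j) (g a) : ι → R)) i =
      ∑ j : S, c j • ((Pi.single a (g (f j)) : ι → R) i - (Pi.single (f j) (g a) : ι → R) i) := by
    simp [Finset.sum_apply]
  refine ⟨h - ∑ j : S, c j • (Pi.single a (g (f j)) - Pi.single (f j) (g a)), ?_, ?_, ?_⟩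
  · rw [sub_sub_cancel]
    exact Submodule.sum_mem _ fun j _ =>
      Submodule.smul_mem _ _ (single_sub_single_mem_koszulSpan g a (f j))
  · rw [Pi.sub_apply, key, sub_eq_zero, ← hc]
    refine Finset.sum_congr rfl fun j _ => ?_
    rw [Pi.single_eq_same, Pi.single_eq_of_ne (ha j j.2).symm, sub_zero]
  · intro i hi hS
    rw [Pi.sub_apply, key, Finset.sum_eq_zero, sub_zero]
    intro j _
    rw [Pi.single_eq_of_ne hi, Pi.single_eq_of_ne (hS j j.2).symm, sub_zero, smul_zero]

/-- The syzygies of a family, each member of which is regular modulo any others, are generated by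
the Koszul relations. -/
theorem mem_koszulSpan_of_regular [Fintype ι] {g : ι → R} {f : κ → ι} (hf : Function.Injective f)
    (hreg : ∀ (T : Finset κ) (a : κ), a ∉ T → ∀ x, x * g (f a) ∈
      Ideal.span ((fun j => g (f j)) '' T) → x ∈ Ideal.span ((fun j => g (f j)) '' T))
    (S : Finset κ) {h : ι → R} (hS : ∀ i, (∀ j ∈ S, f j ≠ i) → h i = 0)
    (hh : h ∈ LinearMap.ker (Fintype.linearCombination R g)) : h ∈ koszulSpan g := by
  classical
  induction S using Finset.induction_on generalizing h with
  | empty =>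
    have : h = 0 := funext fun i => hS i (by simp)
    rw [this]
    exact zero_mem _
  | insert a T ha ih =>
    have hfa : ∀ j ∈ T, f j ≠ f a := fun j hj h => ha (hf h ▸ hj)
    -- The syzygy equation puts h (f a) g (f a) in the ideal of the remaining members, and
    -- regularity cancels g (f a).
    have hmem : h (f a) ∈ Ideal.span ((fun j => g (f j)) '' T) := by
      refine hreg T a ha _ ?_
      have h0 : ∑ i, h i * g i = 0 := by
        simpa [Fintype.linearCombination_apply] using hh
      rw [← Finset.sum_subset (Finset.subset_univ ((insert a T).image f)),
        Finset.sum_image (fun x _ y _ hxy => hf hxy), Finset.sum_insert ha] at h0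
      · rw [eq_neg_of_add_eq_zero_left h0, neg_mem_iff]
        exact Ideal.sum_mem _ fun j hj =>
          Ideal.mul_mem_left _ _ (Ideal.subset_span ⟨j, hj, rfl⟩)
      · intro i _ hi
        rw [hS i, zero_mul]
        intro j hj hji
        exact hi (Finset.mem_image.2 ⟨j, hj, hji⟩)
    obtain ⟨h', h1, h2, h3⟩ := exists_sub_mem_koszulSpan f T hfa hmem
    have h' : h' ∈ koszulSpan g := by
      refine ih (fun i hi => ?_) ?_
      · rcases eq_or_ne i (f a) with rfl | hia
        · exact h2
        · rw [h3 i hia hi]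
          refine hS i fun j hj => ?_
          rcases Finset.mem_insert.1 hj with rfl | hj
          · exact hia.symm
          · exact hi j hj
      · have := sub_mem hh (koszulSpan_le_ker g h1)
        rwa [sub_sub_cancel] at this
    simpa using add_mem h1 h'

end Koszul

/-! ### Regularity of variables and of their sum -/

section Regularity

variable {k : Type*} [Field k] {σ : Type*}

theorem mem_of_mul_X_pow_mem {a : σ → ℕ} {S : Set σ} {i : σ} (hi : i ∉ S) {c : ℕ}
    {f : MvPolynomial σ k}
    (h : f * X i ^ c ∈ Ideal.span ((fun j => (X j : MvPolynomial σ k) ^ a j) '' S)) :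
    f ∈ Ideal.span ((fun j => (X j : MvPolynomial σ k) ^ a j) '' S) := by
  classical
  rw [mem_span_X_pow_image] at h ⊢
  intro m hm
  obtain ⟨j, hj, hle⟩ := h (m + Finsupp.single i c) (by
    rw [mem_support_iff, X_pow_eq_monomial, coeff_mul_monomial, mul_one]
    exact mem_support_iff.1 hm)
  refine ⟨j, hj, ?_⟩
  have : i ≠ j := fun h => hi (h ▸ hj)
  simpa [this] using hle

theorem homogeneousComponent_mul_X_pow (n c : ℕ) (i : σ) (f : MvPolynomial σ k) :
    homogeneousComponent n (f * X i ^ c) =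
      (if c ≤ n then homogeneousComponent (n - c) f else 0) * X i ^ c := by
  classical
  ext m
  rw [coeff_homogeneousComponent, X_pow_eq_monomial, coeff_mul_monomial', coeff_mul_monomial']
  by_cases h : Finsupp.single i c ≤ m
  · obtain ⟨u, rfl⟩ := exists_add_of_le h
    rw [if_pos h, if_pos h, add_tsub_cancel_left, map_add, Finsupp.degree_single]
    split_ifs with h1 h2 h2
    · rw [coeff_homogeneousComponent, if_pos (by omega)]
    · omega
    · rw [coeff_homogeneousComponent, if_neg (by omega), zero_mul]
    · simp
  · simp [h]

variable {N : ℕ}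

/-- The sum of the variables is regular modulo powers of all variables but one. -/
theorem mem_of_sumX_mul_mem {d : ℕ} {f : MvPolynomial (Fin (N + 1)) k}
    (h : sumX k (Fin (N + 1)) * f ∈
      Ideal.span ((fun j => (X j : MvPolynomial (Fin (N + 1)) k) ^ d) '' Set.range Fin.succ)) :
    f ∈ Ideal.span ((fun j => (X j : MvPolynomial (Fin (N + 1)) k) ^ d) ''
      Set.range Fin.succ) := by
  set J := Ideal.span ((fun j => (X j : MvPolynomial (Fin (N + 1)) k) ^ d) '' Set.range Fin.succ)
    with hJ
  -- Modulo J, L is x_0 minus a nilpotent t. With t^K ∈ J, L divides x_0^K - t^K, so L f ∈ J gives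
  -- x_0^K f ∈ J, and x_0 is regular modulo J.
  have hrad : -(∑ j : Fin N, (X j.succ : MvPolynomial (Fin (N + 1)) k)) ∈ J.radical := by
    rw [neg_mem_iff]
    exact Ideal.sum_mem _ fun j _ => ⟨d, Ideal.subset_span ⟨j.succ, ⟨j, rfl⟩, rfl⟩⟩
  obtain ⟨K, hK⟩ := hrad
  have hL : sumX k (Fin (N + 1)) = X 0 - -(∑ j : Fin N, X j.succ) := by
    rw [sumX, Fin.sum_univ_succ, sub_neg_eq_add]
  obtain ⟨W, hW⟩ := sub_dvd_pow_sub_pow (X 0 : MvPolynomial (Fin (N + 1)) k)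
    (-(∑ j : Fin N, X j.succ)) K
  rw [← hL] at hW
  have h0 : (0 : Fin (N + 1)) ∉ Set.range (Fin.succ : Fin N → Fin (N + 1)) := by
    rintro ⟨j, hj⟩
    exact Fin.succ_ne_zero j hj
  refine mem_of_mul_X_pow_mem (a := fun _ => d) h0 (c := K) ?_
  rw [sub_eq_iff_eq_add.1 hW, mul_add]
  refine add_mem ?_ (Ideal.mul_mem_left _ _ hK)
  rw [mul_left_comm, ← mul_assoc, mul_comm, ← mul_assoc, mul_comm _ (sumX _ _)] at *
  convert! Ideal.mul_mem_left _ W h using 1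
  ring

end Regularity

/-! ### Non-Koszul syzygies and killed classes -/

section Syzygies

variable {k : Type*} [Field k] {N : ℕ}

variable (k) in
/-- The forms `x₁^{a₁}, …, x_N^{a_N}, (x₁ + ⋯ + x_N)^{a_{N+1}}`. -/
abbrev succForms (a : Fin (N + 1) → ℕ) : Fin (N + 1) → MvPolynomial (Fin N) k :=
  forms k (N + 1) a

theorem succForms_castSucc (a : Fin (N + 1) → ℕ) (i : Fin N) :
    succForms k a i.castSucc = (X i : MvPolynomial (Fin N) k) ^ a i.castSucc := by
  have : i.castSucc.val < N + 1 - 1 := by simp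
  rw [succForms, forms, dif_pos this]
  rfl

theorem succForms_last (a : Fin (N + 1) → ℕ) :
    succForms k a (Fin.last N) = sumX k (Fin N) ^ a (Fin.last N) := by
  have : ¬ (Fin.last N).val < N + 1 - 1 := by simp
  rw [succForms, forms, dif_neg this]
  rfl

theorem syzBarDeg_eq_bot_iff {n : ℕ} (a : Fin n → ℕ) (i : ℤ) :
    SyzBarDeg k n a i = ⊥ ↔ ∀ h ∈ freeDeg k n a i, h ∈ Syz k n a → h ∈ Kos k n a := by
  rw [SyzBarDeg, Submodule.eq_bot_iff]
  constructor
  · intro H h hd hs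
    have h0 : (Submodule.Quotient.mk ⟨h, hs⟩ : SyzBar k n a) = 0 := H _ ⟨⟨h, hs⟩, hd, rfl⟩
    exact (Submodule.Quotient.mk_eq_zero ((Kos k n a).submoduleOf (Syz k n a))).1 h0
  · rintro H _ ⟨⟨h, hs⟩, hd, rfl⟩
    exact (Submodule.Quotient.mk_eq_zero _).2 (H h hd hs)

theorem E_const {n d : ℕ} (hd : 0 < d) :
    E n (fun _ => d) = (((n * (d - 1) + 3) / 2 : ℕ) : ℤ) := by
  obtain ⟨c, rfl⟩ : ∃ c, d = c + 1 := ⟨d - 1, by omega⟩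
  simp only [E, size, Finset.sum_const, Finset.card_univ, Fintype.card_fin, nsmul_eq_mul,
    Nat.add_sub_cancel]
  push_cast
  congr 1
  ring

/-- Koszul relations clear the last entry; what remains is a syzygy of x_1^d, ..., x_N^d, a regular
family. -/
theorem mem_kos_of_last_mem {d : ℕ} {h : Fin (N + 1) → MvPolynomial (Fin N) k}
    (hs : h ∈ Syz k (N + 1) (fun _ => d)) (hl : h (Fin.last N) ∈ monIdeal k (fun _ => d)) :
    h ∈ Kos k (N + 1) (fun _ => d) := by
  change h ∈ koszulSpan (succForms k fun _ : Fin (N + 1) => d)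
  have hg : (fun j : Fin N => succForms k (fun _ => d) j.castSucc) =
      fun j => (X j : MvPolynomial (Fin N) k) ^ d := funext fun j => succForms_castSucc _ j
  obtain ⟨h', h1, h2, h3⟩ := exists_sub_mem_koszulSpan (g := succForms k fun _ : Fin (N + 1) => d)
    Fin.castSucc Finset.univ (a := Fin.last N) (fun j _ => Fin.castSucc_ne_last j) (h := h) (by
      rw [hg, Finset.coe_univ, Set.image_univ]
      exact hl)
  have h4 : h' ∈ koszulSpan (succForms k fun _ : Fin (N + 1) => d) := by
    refine mem_koszulSpan_of_regular (Fin.castSucc_injective N) ?_ Finset.univ (fun i hi => ?_) ?_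
    · intro T a ha x hx
      rw [hg] at hx ⊢
      rw [succForms_castSucc] at hx
      exact mem_of_mul_X_pow_mem (a := fun _ => d) (by simpa using ha) hx
    · rcases Fin.eq_castSucc_or_eq_last i with ⟨j, rfl⟩ | rfl
      · exact absurd rfl (hi j (Finset.mem_univ j))
      · exact h2
    · have := sub_mem hs (koszulSpan_le_ker _ h1)
      rwa [sub_sub_cancel] at this
  simpa using add_mem h1 h4

/-- The last entry of a non-Koszul syzygy of degree i has degree i - d, and adjoining a variable
turns it into a class of degree i - 1 killed by L. For i < E this is below the middle. -/
theorem leMgd_of_le (p : ℕ) [CharP k p] [Fact p.Prime] {d : ℕ} (hd : 0 < d)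
    (hp : ((N + 1) * (d - 1) + 3) / 2 ≤ p) :
    LeMgd (E (N + 1) fun _ => d) (SyzBarDeg k (N + 1) fun _ => d) := by
  intro i hi
  rw [E_const hd] at hi
  rw [syzBarDeg_eq_bot_iff]
  intro (h : Fin (N + 1) → MvPolynomial (Fin N) k) hdeg hs
  refine mem_kos_of_last_mem hs ?_
  by_contra hl
  have hq : h (Fin.last N) ∈ Qdeg k (N + 1) (i - (d : ℕ)) := hdeg (Fin.last N) trivial
  rw [Qdeg] at hq
  split_ifs at hq with h0
  · have hmem : sumX k (Fin N) ^ d * h (Fin.last N) ∈ monIdeal k (fun _ : Fin N => d) := by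
      have hsum : ∑ j, h j * succForms k (fun _ => d) j = 0 := by
        simpa [Syz, xi, Fintype.linearCombination_apply] using hs
      rw [Fin.sum_univ_castSucc, succForms_last] at hsum
      rw [mul_comm, eq_neg_of_add_eq_zero_right hsum, neg_mem_iff]
      refine Ideal.sum_mem _ fun j _ => Ideal.mul_mem_left _ _ ?_
      rw [succForms_castSucc]
      exact X_pow_mem_monIdeal _ j le_rfl
    have hker := hasKer_cons (N := N) hd hq hl hmem
    have hcons : (Fin.cons d fun _ : Fin N => d : Fin (N + 1) → ℕ) = fun _ => d := by
      ext i
      refine Fin.cases rfl (fun i => rfl) i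
    rw [hcons] at hker
    refine not_hasKer p hd (by simpa using hp) ?_ hker
    rw [Fintype.card_fin]
    generalize (N + 1) * (d - 1) = s at *
    omega
  · exact hl (((Submodule.mem_bot k).1 hq) ▸ zero_mem _)

/-- Write L g as a combination of the x_j^d and substitute x_0 = -(x_1 + ... + x_N): the left side
vanishes and a syzygy of the forms remains. -/
theorem exists_syzygy_of_hasKer {d e : ℕ} (h : HasKer k (fun _ : Fin (N + 1) => d) 1 e) :
    ∃ h ∈ freeDeg k (N + 1) (fun _ => d) (e + 1), h ∈ Syz k (N + 1) (fun _ => d) ∧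
      h ∉ Kos k (N + 1) (fun _ => d) := by
  obtain ⟨g, hg, hgI, hL⟩ := hasKer_one.1 h
  obtain ⟨c', hc'⟩ := Ideal.mem_span_range_iff_exists_fun.1 hL
  set c : Fin (N + 1) → MvPolynomial (Fin (N + 1)) k := fun j =>
    if d ≤ e + 1 then homogeneousComponent (e + 1 - d) (c' j) else 0 with hcdef
  have hc : ∑ j, c j * X j ^ d = sumX k (Fin (N + 1)) * g := by
    have h1 : (sumX k (Fin (N + 1)) * g).IsHomogeneous (e + 1) := by
      rw [add_comm e 1]; exact isHomogeneous_sumX.mul hg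
    rw [← homogeneousComponent_eq_self h1, ← hc', map_sum]
    exact Finset.sum_congr rfl fun j _ => (homogeneousComponent_mul_X_pow _ _ _ _).symm
  set φ : MvPolynomial (Fin (N + 1)) k →ₐ[k] MvPolynomial (Fin N) k :=
    aeval (Fin.cons (-sumX k (Fin N)) X) with hφ
  have hφ0 : φ (X 0) = -sumX k (Fin N) := by simp [hφ]
  have hφs (j : Fin N) : φ (X j.succ) = X j := by simp [hφ]
  have hφL : φ (sumX k (Fin (N + 1))) = 0 := by
    rw [sumX, Fin.sum_univ_succ, map_add, hφ0, map_sum, Finset.sum_congr rfl fun j _ => hφs j, sumX,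
      neg_add_cancel]
  have hφd (j : Fin (N + 1)) : φ (c j) ∈ Qdeg k (N + 1) ((e : ℤ) + 1 - d) := by
    simp only [hcdef, Qdeg]
    split_ifs with h1 h2 h2
    · have := (homogeneousComponent_isHomogeneous (e + 1 - d) (c' j)).aeval (S := k)
        (Fin.cons (-sumX k (Fin N)) X) (n := 1) (fun i => by
          refine Fin.cases ?_ (fun i => ?_) i
          · exact isHomogeneous_sumX.neg
          · exact isHomogeneous_X _ _)
      rw [one_mul] at this
      rwa [show ((e : ℤ) + 1 - d).toNat = e + 1 - d by omega]
    · rw [map_zero]; exact zero_mem _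
    · omega
    · rw [map_zero]; exact zero_mem _
  set v : Fin (N + 1) → MvPolynomial (Fin N) k :=
    Fin.snoc (fun j => φ (c j.succ)) ((-1) ^ d * φ (c 0)) with hv
  have hvc (j : Fin N) : v j.castSucc = φ (c j.succ) := by simp [hv]
  have hvl : v (Fin.last N) = (-1) ^ d * φ (c 0) := by simp [hv]
  refine ⟨v, ?_, ?_, ?_⟩
  · rintro i -
    rcases Fin.eq_castSucc_or_eq_last i with ⟨j, rfl⟩ | rfl
    · rw [hvc]; exact hφd _
    · rw [hvl]
      rcases neg_one_pow_eq_or (MvPolynomial (Fin N) k) d with h1 | h1 <;> rw [h1]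
      · rw [one_mul]; exact hφd _
      · rw [neg_one_mul]; exact neg_mem (hφd _)
  · have h0 : ∑ j, v j * succForms k (fun _ => d) j = 0 := by
      rw [Fin.sum_univ_castSucc, succForms_last, hvl]
      have := congrArg φ hc
      rw [map_mul, hφL, zero_mul, map_sum, Fin.sum_univ_succ, map_mul, map_pow, hφ0] at this
      rw [← this, add_comm, neg_pow]
      congr 1
      · ring
      · refine Finset.sum_congr rfl fun j _ => ?_
        rw [hvc, succForms_castSucc, map_mul, map_pow, hφs]
    simpa [Syz, xi, Fintype.linearCombination_apply] using h0
  · intro hk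
    have hle : Kos k (N + 1) (fun _ => d) ≤ Submodule.comap (LinearMap.proj (Fin.last N))
        (monIdeal k (fun _ : Fin N => d)) := by
      refine Submodule.span_le.2 ?_
      rintro _ ⟨i, j, hij, rfl⟩
      -- Since i < j, the last entry of a Koszul relation is 0 or -x_i^d, never a multiple of the
      -- power of the sum.
      have hi : Fin.last N ≠ i := (lt_of_lt_of_le hij (Fin.le_last j)).ne'
      obtain ⟨i, rfl⟩ := Fin.eq_castSucc_of_ne_last hi.symm
      simp only [SetLike.mem_coe, Submodule.mem_comap, LinearMap.proj_apply, Pi.sub_apply,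
        Pi.single_eq_of_ne hi, zero_sub, neg_mem_iff]
      rcases eq_or_ne (Fin.last N) j with rfl | hj
      · rw [Pi.single_eq_same]
        change succForms k (fun _ => d) i.castSucc ∈ _
        rw [succForms_castSucc]
        exact X_pow_mem_monIdeal _ i le_rfl
      · rw [Pi.single_eq_of_ne hj]
        exact zero_mem _
    have h0 : φ (c 0) ∈ monIdeal k (fun _ : Fin N => d) := by
      have : v (Fin.last N) ∈ monIdeal k (fun _ : Fin N => d) := hle hk
      rw [hvl] at this
      have := Ideal.mul_mem_left _ ((-1) ^ d) this
      rwa [← mul_assoc, ← mul_pow, neg_one_mul, neg_neg, one_pow, one_mul] at this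
    set J := Ideal.span ((fun j => (X j : MvPolynomial (Fin (N + 1)) k) ^ d) ''
      Set.range Fin.succ) with hJ
    have hJI : J ≤ monIdeal k (fun _ : Fin (N + 1) => d) :=
      Ideal.span_mono (Set.image_subset_range _ _)
    have h1 : rename Fin.succ (φ (c 0)) ∈ J := by
      have : monIdeal k (fun _ : Fin N => d) ≤ J.comap (rename (R := k) Fin.succ) := by
        refine Ideal.span_le.2 ?_
        rintro _ ⟨i, rfl⟩
        have : (X i.succ : MvPolynomial (Fin (N + 1)) k) ^ d ∈ J :=
          Ideal.subset_span ⟨i.succ, ⟨i, rfl⟩, rfl⟩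
        simpa using this
      exact this h0
    have h2 : c 0 - rename Fin.succ (φ (c 0)) ∈ Ideal.span {sumX k (Fin (N + 1))} := by
      rw [← Ideal.Quotient.eq]
      have : Ideal.Quotient.mkₐ k (Ideal.span {sumX k (Fin (N + 1))}) =
          ((Ideal.Quotient.mkₐ k (Ideal.span {sumX k (Fin (N + 1))})).comp
            (rename Fin.succ)).comp φ := by
        refine MvPolynomial.algHom_ext fun i => ?_
        refine Fin.cases ?_ (fun i => ?_) i
        · simp only [AlgHom.comp_apply, hφ0, Ideal.Quotient.mkₐ_eq_mk]
          rw [Ideal.Quotient.eq, Ideal.mem_span_singleton]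
          simp [sumX, Fin.sum_univ_succ]
        · simp only [AlgHom.comp_apply, hφs, rename_X]
      exact DFunLike.congr_fun this (c 0)
    obtain ⟨w, hw⟩ := Ideal.mem_span_singleton'.1 h2
    -- Modulo J, c_0 equals w L, so L (g - w x_0^d) ∈ J and L can be cancelled. This forces g into
    -- the full monomial ideal.
    have h3 : g - w * X 0 ^ d ∈ J := by
      refine mem_of_sumX_mul_mem ?_
      have : sumX k (Fin (N + 1)) * (g - w * X 0 ^ d) =
          rename Fin.succ (φ (c 0)) * X 0 ^ d + ∑ j : Fin N, c j.succ * X j.succ ^ d := by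
        rw [mul_sub, ← hc, Fin.sum_univ_succ, ← sub_eq_iff_eq_add'.2 (sub_eq_iff_eq_add.1 hw.symm)]
        ring
      rw [this]
      exact add_mem (Ideal.mul_mem_right _ _ h1) (Ideal.sum_mem _ fun j _ =>
        Ideal.mul_mem_left _ _ (Ideal.subset_span ⟨j.succ, ⟨j, rfl⟩, rfl⟩))
    have h4 := add_mem (hJI h3) ((monIdeal k (fun _ : Fin (N + 1) => d)).mul_mem_left w
      (X_pow_mem_monIdeal (k := k) (fun _ : Fin (N + 1) => d) 0 le_rfl))
    rw [sub_add_cancel] at h4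
    exact hgI h4

end Syzygies

/-! ### Gorenstein duality -/

section Duality

variable {k : Type*} [Field k] {σ : Type*} [Fintype σ]

/-- Failure of surjectivity in one degree gives, by Gorenstein duality, a kernel element in the
complementary degree. -/
theorem hasKer_of_not_surjective {d i : ℕ} (hd : 0 < d) {f : MvPolynomial σ k}
    (hf : f.IsHomogeneous (i + 1))
    (hns : ¬ ∃ h : MvPolynomial σ k, h.IsHomogeneous i ∧
      f - sumX k σ * h ∈ monIdeal k (fun _ : σ => d)) :
    i + 1 ≤ Fintype.card σ * (d - 1) ∧
      HasKer k (fun _ : σ => d) 1 (Fintype.card σ * (d - 1) - (i + 1)) := by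
  classical
  set I := monIdeal k (fun _ : σ => d)
  have hfW : f ∉ (homogeneousSubmodule σ k i).map (LinearMap.mulLeft k (sumX k σ)) ⊔
      I.restrictScalars k := by
    rw [Submodule.mem_sup]
    rintro ⟨_, ⟨h, hh, rfl⟩, j, hj, hfj⟩
    refine hns ⟨h, hh, ?_⟩
    rw [← hfj, LinearMap.mulLeft_apply, add_sub_cancel_left]
    exact hj
  obtain ⟨φ, hφf, hφ⟩ := Submodule.exists_le_ker_of_notMem hfW
  have hφI {x : MvPolynomial σ k} (hx : x ∈ I) : φ x = 0 := hφ (Submodule.mem_sup_right hx)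
  have hφL {h : MvPolynomial σ k} (hh : h.IsHomogeneous i) : φ (sumX k σ * h) = 0 :=
    hφ (Submodule.mem_sup_left ⟨h, hh, rfl⟩)
  -- The functional φ separates f from L A_i + I. Cutting it off outside degree i + 1 makes the dual
  -- polynomial g homogeneous.
  let ψ : (σ →₀ ℕ) → k := fun u => if u.degree = i + 1 then φ (monomial u 1) else 0
  have hψI (u : σ →₀ ℕ) (hu : ∃ j, d ≤ u j) : ψ u = 0 := by
    simp only [ψ]
    split_ifs
    · exact hφI (monomial_mem_monIdeal 1 hu)
    · rfl
  have hψL (u : σ →₀ ℕ) : ∑ j, ψ (Finsupp.single j 1 + u) = 0 := by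
    simp only [ψ, map_add, Finsupp.degree_single]
    split_ifs with h
    · rw [← hφL (isHomogeneous_monomial (R := k) (d := u) 1 (n := i) (by omega)), sumX,
        Finset.sum_mul, map_sum]
      exact Finset.sum_congr rfl fun j _ => by rw [X, monomial_mul, one_mul]
    · simp
  let δ : σ →₀ ℕ := Finsupp.equivFunOnFinite.symm fun _ => d - 1
  have hδ (j : σ) : δ j = d - 1 := rfl
  have hδdeg : δ.degree = Fintype.card σ * (d - 1) := by simp [Finsupp.degree_eq_sum, hδ]
  -- The Macaulay dual of φ under the pairing into the socle monomial x^δ. The coefficient of x^m in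
  -- L g is φ(L x^(δ-m)) when δ - m has degree i, and zero otherwise.
  let g : MvPolynomial σ k := ∑ m ∈ Finset.Iic δ, monomial m (ψ (δ - m))
  have hg (m : σ →₀ ℕ) (hm : m ≤ δ) : coeff m g = ψ (δ - m) := by
    simp only [g, coeff_sum, coeff_monomial]
    rw [Finset.sum_ite_eq' (Finset.Iic δ) m, if_pos (Finset.mem_Iic.2 hm)]
  obtain ⟨u, huf, hu⟩ : ∃ u ∈ f.support, φ (monomial u 1) ≠ 0 := by
    by_contra! h
    refine hφf ?_
    rw [f.as_sum, map_sum]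
    refine Finset.sum_eq_zero fun u hu => ?_
    rw [← mul_one (coeff u f), ← smul_eq_mul, ← smul_monomial, map_smul, h u hu, smul_zero]
  have hudeg : u.degree = i + 1 := coeff_ne_zero_degree hf (mem_support_iff.1 huf)
  have hud (j : σ) : u j < d := by
    by_contra! h
    exact hu (hφI (monomial_mem_monIdeal 1 ⟨j, h⟩))
  have huδ : u ≤ δ := fun j => by rw [hδ]; have := hud j; omega
  have hcard : i + 1 ≤ Fintype.card σ * (d - 1) := by
    rw [← hδdeg, ← hudeg]
    exact Finsupp.degree_mono huδ
  refine ⟨hcard, hasKer_one.2 ⟨g, ?_, ?_, ?_⟩⟩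
  · refine IsHomogeneous.sum _ _ _ fun m hm => ?_
    have hm' := Finset.mem_Iic.1 hm
    by_cases h : (δ - m).degree = i + 1
    · refine isHomogeneous_monomial _ ?_
      have : (δ - m).degree + m.degree = δ.degree := by
        rw [← map_add, tsub_add_cancel_of_le hm']
      omega
    · simp only [ψ, if_neg h, map_zero]
      exact isHomogeneous_zero _ _ _
  · refine notMem_monIdeal.2 ⟨δ - u, fun j => ?_, ?_⟩
    · rw [Finsupp.tsub_apply, hδ]
      omega
    · rw [hg _ tsub_le_self, tsub_tsub_cancel_of_le huδ]
      simp only [ψ, if_pos hudeg]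
      exact hu
  · rw [mem_monIdeal]
    intro m hm
    rw [sumX, Finset.sum_mul, coeff_sum, ← hψL (δ - m)]
    refine Finset.sum_congr rfl fun j _ => ?_
    rw [coeff_X_mul']
    split_ifs with h
    · rw [hg]
      · congr 1
        ext l
        have := hm l
        have h0 : m j ≠ 0 := Finsupp.mem_support_iff.1 h
        rcases eq_or_ne j l with rfl | hl
        · simp [hδ]; omega
        · simp [hδ, hl]
      · intro l
        have := hm l
        rw [Finsupp.tsub_apply, hδ]
        omega
    · refine (hψI _ ⟨j, ?_⟩).symm
      have h0 : m j = 0 := by simpa using h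
      simp [hδ, h0]
      omega

end Duality

/-! ### The weak Lefschetz property -/

section WeakLefschetz

variable {k : Type*} [Field k] {n : ℕ}

theorem mem_Adeg {a : Fin n → ℕ} {i : ℕ} {f : MvPolynomial (Fin n) k} (hf : f.IsHomogeneous i) :
    Ideal.Quotient.mk (powIdeal k n a) f ∈ Adeg k n a i :=
  ⟨f, hf, rfl⟩

theorem mk_eq_zero_iff {a : Fin n → ℕ} {f : MvPolynomial (Fin n) k} :
    Ideal.Quotient.mk (powIdeal k n a) f = 0 ↔ f ∈ monIdeal k a :=
  Ideal.Quotient.eq_zero_iff_mem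

theorem injective_mulMap_iff {a : Fin n → ℕ} {f : MvPolynomial (Fin n) k}
    (hL : Ideal.Quotient.mk (powIdeal k n a) f ∈ Adeg k n a 1) (i : ℕ) :
    Function.Injective (mulMap (Adeg k n a) hL i) ↔
      ∀ g : MvPolynomial (Fin n) k, g.IsHomogeneous i → f * g ∈ monIdeal k a →
        g ∈ monIdeal k a := by
  rw [injective_iff_map_eq_zero]
  constructor
  · intro h g hg hfg
    have := h ⟨_, mem_Adeg hg⟩ (Subtype.ext (by
      change Ideal.Quotient.mk (powIdeal k n a) g * Ideal.Quotient.mk (powIdeal k n a) f = 0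
      rwa [← map_mul, mk_eq_zero_iff, mul_comm]))
    exact mk_eq_zero_iff.1 (congrArg Subtype.val this)
  · rintro h ⟨_, g, hg, rfl⟩ hx
    refine Subtype.ext (mk_eq_zero_iff.2 (h g hg ?_))
    have := congrArg Subtype.val hx
    change Ideal.Quotient.mk (powIdeal k n a) g * Ideal.Quotient.mk (powIdeal k n a) f = 0 at this
    rwa [← map_mul, mk_eq_zero_iff, mul_comm] at this

theorem surjective_mulMap_iff {a : Fin n → ℕ} {f : MvPolynomial (Fin n) k}
    (hL : Ideal.Quotient.mk (powIdeal k n a) f ∈ Adeg k n a 1) (i : ℕ) :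
    Function.Surjective (mulMap (Adeg k n a) hL i) ↔
      ∀ g : MvPolynomial (Fin n) k, g.IsHomogeneous (i + 1) →
        ∃ h : MvPolynomial (Fin n) k, h.IsHomogeneous i ∧ g - f * h ∈ monIdeal k a := by
  constructor
  · intro H g hg
    obtain ⟨⟨_, h, hh, rfl⟩, hx⟩ := H ⟨_, mem_Adeg hg⟩
    refine ⟨h, hh, ?_⟩
    have := congrArg Subtype.val hx
    change Ideal.Quotient.mk (powIdeal k n a) h * Ideal.Quotient.mk (powIdeal k n a) f =
      Ideal.Quotient.mk (powIdeal k n a) g at this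
    rw [← map_mul] at this
    rw [mul_comm]
    exact Ideal.Quotient.eq.1 this.symm
  · rintro H ⟨_, g, hg, rfl⟩
    obtain ⟨h, hh, hgh⟩ := H g hg
    refine ⟨⟨_, mem_Adeg hh⟩, Subtype.ext ?_⟩
    change Ideal.Quotient.mk (powIdeal k n a) h * Ideal.Quotient.mk (powIdeal k n a) f =
      Ideal.Quotient.mk (powIdeal k n a) g
    rw [← map_mul, mul_comm]
    exact (Ideal.Quotient.eq.2 hgh).symm

/-- The Lefschetz element is L. From the middle on, a failure of surjectivity at i would dualize to
a killed class in degree n(d-1) - (i+1), again below the middle. -/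
theorem hasWLP_of_forall_not_hasKer {d : ℕ} (hd : 0 < d)
    (h : ∀ e, 2 * e + 1 ≤ n * (d - 1) → ¬ HasKer k (fun _ : Fin n => d) 1 e) :
    HasWLP (Adeg k n fun _ => d) := by
  refine ⟨_, mem_Adeg isHomogeneous_sumX, fun i => ?_⟩
  rw [injective_mulMap_iff, surjective_mulMap_iff]
  by_cases hi : 2 * i + 1 ≤ n * (d - 1)
  · left
    intro g hg hL
    by_contra hgI
    exact h i hi (hasKer_one.2 ⟨g, hg, hgI, hL⟩)
  · right
    intro g hg
    by_contra hns
    obtain ⟨h1, h2⟩ := hasKer_of_not_surjective hd hg hns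
    rw [Fintype.card_fin] at h1 h2
    exact h _ (by omega) h2

/-- Maximal rank up to the middle degree means injectivity. -/
theorem injective_of_surjective {d i : ℕ} {f : MvPolynomial (Fin n) k}
    (hi : 2 * i + 1 ≤ n * (d - 1))
    (hsurj : ∀ g : MvPolynomial (Fin n) k, g.IsHomogeneous (i + 1) →
      ∃ h : MvPolynomial (Fin n) k, h.IsHomogeneous i ∧
        g - f * h ∈ monIdeal k (fun _ : Fin n => d))
    {g : MvPolynomial (Fin n) k} (hg : g.IsHomogeneous i)
    (hfg : f * g ∈ monIdeal k (fun _ : Fin n => d)) :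
    g ∈ monIdeal k (fun _ : Fin n => d) := by
  by_contra hgI
  obtain ⟨w, hw, hwg⟩ := exists_mul_notMem (n * (d - 1) - 1 - 2 * i) hg hgI
    (by rw [Fintype.card_fin]; omega)
  obtain ⟨v, hv, hvg⟩ := exists_mul_notMem (i + 1) (hw.mul hg) hwg
    (by rw [Fintype.card_fin]; omega)
  -- Modulo the ideal v = f h, so v w g = h w (f g) vanishes there, contradicting the choice of v.
  obtain ⟨h, -, hh⟩ := hsurj v hv
  refine hvg ?_
  have h1 := Ideal.mul_mem_right (w * g) _ hh
  have h2 := Ideal.mul_mem_left _ (h * w) hfg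
  convert! add_mem h1 h2 using 1
  ring

theorem exists_sum_C_mul_X {f : MvPolynomial (Fin n) k} (hf : f.IsHomogeneous 1) :
    ∃ c : Fin n → k, f = ∑ j, C (c j) * X j := by
  have h : f ∈ homogeneousSubmodule (Fin n) k 1 := hf
  rw [homogeneousSubmodule_one_eq_span_X] at h
  obtain ⟨c, rfl⟩ := (Submodule.mem_span_range_iff_exists_fun k).1 h
  exact ⟨c, Finset.sum_congr rfl fun j _ => smul_eq_C_mul _ _⟩

/-- Over an infinite field, a linear form acting injectively can be perturbed to one with all
coefficients nonzero. -/
theorem exists_forall_ne_zero_of_injective [Infinite k] {a : Fin n → ℕ} {i : ℕ} {c : Fin n → k}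
    (h : ∀ g : MvPolynomial (Fin n) k, g.IsHomogeneous i →
      (∑ j, C (c j) * X j) * g ∈ monIdeal k a → g ∈ monIdeal k a) :
    ∃ c' : Fin n → k, (∀ j, c' j ≠ 0) ∧ ∀ g : MvPolynomial (Fin n) k, g.IsHomogeneous i →
      (∑ j, C (c' j) * X j) * g ∈ monIdeal k a → g ∈ monIdeal k a := by
  classical
  have hom (b : Fin n → k) : (∑ j, C (b j) * X j : MvPolynomial (Fin n) k).IsHomogeneous 1 :=
    IsHomogeneous.sum _ _ _ fun j _ => isHomogeneous_C_mul_X _ _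
  set b : Fin n → k := fun j => if c j = 0 then 1 else 0 with hb
  set M := mulMap (Adeg k n a) (mem_Adeg (hom c)) i with hM
  set B := mulMap (Adeg k n a) (mem_Adeg (hom b)) i with hB
  have hMinj : Function.Injective M := (injective_mulMap_iff _ _).2 h
  obtain ⟨S, hS⟩ := M.exists_leftInverse_of_injective (LinearMap.ker_eq_bot.2 hMinj)
  have : Module.Finite k (Adeg k n a i) :=
    Module.Finite.iff_fg.2 ((homogeneousSubmodule_fg (Fin n) k i).map _)
  let T : Module.End k (Adeg k n a i) := S ∘ₗ B
  -- A class x killed by the perturbed form satisfies M x = μ⁻¹ B x, so T x = μ x. Only finitely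
  -- many μ are eigenvalues of T, and an infinite field has another, nonzero one.
  obtain ⟨μ, hμ⟩ := (T.finite_hasEigenvalue.union (Set.finite_singleton 0)).exists_notMem
  simp only [Set.mem_union, Set.mem_ofPred_eq, Set.mem_singleton_iff, not_or] at hμ
  obtain ⟨hμ, hμ0⟩ := hμ
  refine ⟨fun j => c j - μ⁻¹ * b j, fun j => ?_, fun g hg hgI => ?_⟩
  · simp only [hb]
    split_ifs with h0 <;> simp [h0, hμ0]
  · set x : Adeg k n a i := ⟨_, mem_Adeg hg⟩ with hx
    have hMB : M x - μ⁻¹ • B x = 0 := by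
      refine Subtype.ext ?_
      change Ideal.Quotient.mk (powIdeal k n a) g * Ideal.Quotient.mk (powIdeal k n a) _ -
        μ⁻¹ • (Ideal.Quotient.mk (powIdeal k n a) g * Ideal.Quotient.mk (powIdeal k n a) _) = 0
      have hsmul (t : k) (y : MvPolynomial (Fin n) k) :
          t • Ideal.Quotient.mk (powIdeal k n a) y =
            Ideal.Quotient.mk (powIdeal k n a) (C t * y) := by
        rw [← smul_eq_C_mul]; rfl
      rw [← map_mul, ← map_mul, hsmul, ← map_sub, mk_eq_zero_iff]
      convert! hgI using 1
      simp only [Finset.mul_sum, Finset.sum_mul, ← Finset.sum_sub_distrib]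
      refine Finset.sum_congr rfl fun j _ => ?_
      rw [C_sub, C_mul]
      ring
    have hTx : T x = μ • x := by
      have h1 := congrArg S hMB
      rw [map_sub, map_smul, map_zero, ← LinearMap.comp_apply, hS, LinearMap.id_apply,
        sub_eq_zero] at h1
      change S (B x) = μ • x
      exact ((inv_smul_eq_iff₀ hμ0).1 h1.symm)
    have hx0 : x = 0 := by
      by_contra hne
      exact hμ (Module.End.hasEigenvalue_of_hasEigenvector
        ⟨Module.End.mem_eigenspace_iff.2 hTx, hne⟩)
    exact mk_eq_zero_iff.1 (congrArg Subtype.val hx0)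

variable {σ : Type*}

theorem aeval_C_mul_X_mem {a : σ → ℕ} (c : σ → k) {g : MvPolynomial σ k}
    (hg : g ∈ monIdeal k a) : aeval (fun j => C (c j) * X j) g ∈ monIdeal k a := by
  have : monIdeal k a ≤ (monIdeal k a).comap
      (aeval (R := k) fun j => (C (c j) * X j : MvPolynomial σ k)) := by
    refine Ideal.span_le.2 ?_
    rintro _ ⟨j, rfl⟩
    simpa [mul_pow] using Ideal.mul_mem_left _ (C (c j) ^ a j) (X_pow_mem_monIdeal a j le_rfl)
  exact this hg

theorem aeval_C_mul_X_mem_iff {a : σ → ℕ} {c : σ → k} (hc : ∀ j, c j ≠ 0)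
    {g : MvPolynomial σ k} :
    aeval (fun j => C (c j) * X j) g ∈ monIdeal k a ↔ g ∈ monIdeal k a := by
  refine ⟨fun h => ?_, aeval_C_mul_X_mem c⟩
  have h1 := aeval_C_mul_X_mem (fun j => (c j)⁻¹) h
  have h2 : (aeval (R := k) fun j => (C (c j)⁻¹ * X j : MvPolynomial σ k)).comp
      (aeval fun j => C (c j) * X j) = AlgHom.id k _ := by
    refine MvPolynomial.algHom_ext fun j => ?_
    rw [AlgHom.comp_apply, aeval_X, map_mul, aeval_X, ← algebraMap_eq, AlgHom.commutes,
      algebraMap_eq, ← mul_assoc, ← C_mul, mul_inv_cancel₀ (hc j), C_1, one_mul, AlgHom.id_apply]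
  rwa [← AlgHom.comp_apply, h2] at h1

/-- Rescaling x_j ↦ c'_j x_j preserves the monomial ideal and carries L to the perturbed Lefschetz
form, so a class killed by L would give one killed by an injective form. -/
theorem not_hasKer_of_hasWLP [Infinite k] {d e : ℕ} (hwlp : HasWLP (Adeg k n fun _ => d))
    (he : 2 * e + 1 ≤ n * (d - 1)) : ¬ HasKer k (fun _ : Fin n => d) 1 e := by
  intro hker
  obtain ⟨g, hg, hgI, hL⟩ := hasKer_one.1 hker
  obtain ⟨_, ⟨f, hf, rfl⟩, hrank⟩ := hwlp
  have hinj : ∀ g : MvPolynomial (Fin n) k, g.IsHomogeneous e →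
      f * g ∈ monIdeal k (fun _ => d) → g ∈ monIdeal k (fun _ => d) := by
    rcases hrank e with h | h
    · exact (injective_mulMap_iff _ _).1 h
    · exact fun g hg => injective_of_surjective he ((surjective_mulMap_iff _ _).1 h) hg
  obtain ⟨c, rfl⟩ := exists_sum_C_mul_X hf
  obtain ⟨c', hc', hinj'⟩ := exists_forall_ne_zero_of_injective hinj
  refine hgI ((aeval_C_mul_X_mem_iff hc').1 (hinj' _ ?_ ?_))
  · simpa using hg.aeval (S := k) (fun j => C (c' j) * X j) (n := 1)
      fun j => isHomogeneous_C_mul_X _ _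
  · have := aeval_C_mul_X_mem c' hL
    rw [map_mul, sumX, map_sum] at this
    simpa only [aeval_X] using this

end WeakLefschetz

end LefschetzCI

end

theorem theorem6p5 (k : Type*) [Field k] (p : ℕ) [CharP k p] (hp : 0 < p)
    (n d : ℕ) (hn : 5 ≤ n) (hd : 0 < d) :
    (LefschetzCI.LeMgd (LefschetzCI.E n (fun _ => d)) (LefschetzCI.SyzBarDeg k n (fun _ => d)) ↔
      LefschetzCI.E n (fun _ => d) ≤ (p : ℤ)) ∧
    (Infinite k →
      (LefschetzCI.HasWLP (LefschetzCI.Adeg k n (fun _ => d)) ↔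
        ((n : ℤ) * ((d : ℤ) - 1) + 3) / 2 ≤ (p : ℤ))) := by
  have : Fact p.Prime := ⟨(CharP.char_is_prime_or_zero k p).resolve_right hp.ne'⟩
  have hE : ((n : ℤ) * ((d : ℤ) - 1) + 3) / 2 = (((n * (d - 1) + 3) / 2 : ℕ) : ℤ) := by
    push_cast [Nat.cast_sub (Nat.one_le_iff_ne_zero.2 hd.ne')]
    rfl
  rw [hE, LefschetzCI.E_const hd, Nat.cast_le]
  refine ⟨⟨fun h => ?_, fun h => ?_⟩, fun _ => ⟨fun h => ?_, fun h => ?_⟩⟩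
  · by_contra! hlt
    obtain ⟨e, he, hker⟩ := LefschetzCI.exists_hasKer (k := k) p hn hd hlt
    obtain ⟨N, rfl⟩ : ∃ N, n = N + 1 := ⟨n - 1, by omega⟩
    obtain ⟨v, hv, hvs, hvk⟩ := LefschetzCI.exists_syzygy_of_hasKer hker
    refine hvk ((LefschetzCI.syzBarDeg_eq_bot_iff _ _).1 (h _ ?_) v hv hvs)
    generalize (N + 1) * (d - 1) = s at *
    omega
  · obtain ⟨N, rfl⟩ : ∃ N, n = N + 1 := ⟨n - 1, by omega⟩
    rw [← LefschetzCI.E_const hd]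
    exact LefschetzCI.leMgd_of_le p hd h
  · by_contra! hlt
    obtain ⟨e, he, hker⟩ := LefschetzCI.exists_hasKer (k := k) p hn hd hlt
    exact LefschetzCI.not_hasKer_of_hasWLP h he hker
  · exact LefschetzCI.hasWLP_of_forall_not_hasKer hd fun e he =>
      LefschetzCI.not_hasKer p hd (by simpa using h) (by simpa using he)
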